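/- Let $\mathbb W\neq\{0\}$ be a finite-dimensional real inner product space. Let $\diamond_1,\dots,\diamond_s$ be bilinear products on $\mathbb W$, each of which makes $\mathbb W$ a Euclidean Jordan algebra: $\diamond_i$ is commutative, satisfies $x^2\diamond_i(x\diamond_i y)=x\diamond_i(x^2\diamond_i y)$ with $x^2=x\diamond_i x$, has an identity element $e_i$, and admits some inner product $\langle\cdot,\cdot\rangle_i$ on $\mathbb W$ (which may depend on $i$) with $\langle x,y\diamond_i z\rangle_i=\langle x\diamond_i y,z\rangle_i$ for all $x,y,z$. Let $\mathcal K^i=\{x\diamond_i x: x\in\mathbb W\}$ be its cone of squares and put $\mathcal K_2=\bigcap_{i=1}^s\mathcal K^i$. Let $r_i$ be the rank of $(\mathbb W,\diamond_i)$, that is, the largest degree of an element, where the degree of $x$ is the least integer $k\ge1$ such that $e_i,x,\dots,x^k$ are linearly dependent (powers with respect to $\diamond_i$). Let $\chi_x(\lambda)=\lambda^{r_i}-a_1(x)\lambda^{r_i-1}+\dots+(-1)^{r_i}a_{r_i}(x)$ be the characteristic polynomial of $x$ in $(\mathbb W,\diamond_i)$, that is, the unique monic polynomial of degree $r_i$ that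 annihilates $x$ for every $x\in\mathbb W$ and whose coefficients are polynomial functions of $x$; and let $\det_i(x)=a_{r_i}(x)$, the product of the roots of $\chi_x$ with multiplicity. Let $\beta_1,\dots,\beta_s>0$ with $\sum_{i=1}^s\beta_i=1$, and let $$f(y)=\sum_{i=1}^s\beta_i\,r_i^{-1}\ln{\det}_i(y),\qquad y\in\operatorname{int}\mathcal K_2 .$$ Then, for every $y\in\operatorname{int}\mathcal K_2$, all $\det_i(y)$ are positive, $f$ is differentiable at $y$, and $\langle\nabla f(y),w\rangle>0$ for every nonzero $w\in\mathcal K_2$; and for every $w\in\mathcal K_2$ the function $$\psi_w(y)=\ln\langle\nabla f(y),w\rangle$$ is convex on $\operatorname{int}\mathcal K_2$. (For $w=0$ the function $\psi_w$ is constant, and the claim is trivial.) -/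

import Mathlib

open Polynomial

/-- A Jordan product on `W` with identity `one` that makes `W` a Euclidean Jordan algebra: a
commutative bilinear product satisfying the Jordan identity, for which some inner product on `W`
(given here as a symmetric positive definite bilinear form) is associative. -/
structure EuclideanJordanProduct (W : Type*) [AddCommGroup W] [Module ℝ W] where
  /-- the bilinear product `x ∘ y` -/
  mul : W →ₗ[ℝ] W →ₗ[ℝ] W
  /-- the identity element -/
  one : W
  mul_comm : ∀ x y, mul x y = mul y x
  jordan : ∀ x y, mul (mul x x) (mul x y) = mul x (mul (mul x x) y)
  one_mul : ∀ x, mul one x = x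
  exists_inner : ∃ B : W →ₗ[ℝ] W →ₗ[ℝ] ℝ,
    (∀ x y, B x y = B y x) ∧ (∀ x, x ≠ 0 → 0 < B x x) ∧
      ∀ x y z, B x (mul y z) = B (mul x y) z

/-- `g` is a polynomial function on the real vector space `W`, that is, a polynomial in (finitely
many) linear functionals. -/
def IsPolynomialFunction {W : Type*} [AddCommGroup W] [Module ℝ W] (g : W → ℝ) : Prop :=
  ∃ p : MvPolynomial (Module.Dual ℝ W) ℝ, ∀ x, g x = MvPolynomial.eval (fun ℓ => ℓ x) p

/-- Over an integrally closed domain, the monic polynomial of least degree that kills the vector `v`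
under the matrix `M` has coefficients in the domain, and the vectors `M ^ j v` below its degree have a
dual system up to a nonzero factor. -/
theorem exists_monic_krylov {R : Type*} [CommRing R] [IsDomain R] [IsIntegrallyClosed R] {n : ℕ}
    (M : Matrix (Fin n) (Fin n) R) (v : Fin n → R) :
    ∃ G : R[X], G.Monic ∧ (aeval M G).mulVec v = 0 ∧
      ∃ q : R, q ≠ 0 ∧ ∃ N : Fin G.natDegree → Fin n → R,
        ∀ i j : Fin G.natDegree, N i ⬝ᵥ ((M ^ (j : ℕ)).mulVec v) = if i = j then q else 0 := by
  classical
  let K := FractionRing R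
  let ι : R →+* K := algebraMap R K
  have hι : Function.Injective ι := IsFractionRing.injective R K
  let MK : Matrix (Fin n) (Fin n) K := ι.mapMatrix M
  let vK : Fin n → K := ι ∘ v
  have hpow : ∀ k : ℕ, (MK ^ k).mulVec vK = ι ∘ ((M ^ k).mulVec v) := by
    intro k
    have : MK ^ k = (M ^ k).map ι := by
      simp only [MK, ← map_pow]; rfl
    rw [this]
    funext i
    exact (RingHom.map_mulVec ι (M ^ k) v i).symm
  let I : Ideal K[X] :=
    { carrier := {p | (aeval MK p).mulVec vK = 0}
      add_mem' := by
        intro a b ha hb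
        simp only [Set.mem_ofPred_eq] at *
        rw [map_add, Matrix.add_mulVec, ha, hb, add_zero]
      zero_mem' := by simp
      smul_mem' := by
        intro c x hx
        simp only [Set.mem_ofPred_eq, smul_eq_mul] at *
        rw [map_mul, ← Matrix.mulVec_mulVec, hx, Matrix.mulVec_zero] }
  have hI : ∀ p, p ∈ I ↔ (aeval MK p).mulVec vK = 0 := fun p => Iff.rfl
  let g := Submodule.IsPrincipal.generator I
  have hgI : g ∈ I := Submodule.IsPrincipal.generator_mem I
  have hdvd : ∀ p, p ∈ I → g ∣ p := fun p hp =>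
    (Submodule.IsPrincipal.mem_iff_generator_dvd I).1 hp
  have hchar : M.charpoly.map ι ∈ I := by
    rw [hI, show M.charpoly.map ι = MK.charpoly from (Matrix.charpoly_map M ι).symm,
      Matrix.aeval_self_charpoly, Matrix.zero_mulVec]
  obtain ⟨G, hG⟩ := IsIntegrallyClosed.eq_map_mul_C_of_dvd K (Matrix.charpoly_monic M)
    (hdvd _ hchar)
  change G.map ι * C g.leadingCoeff = g at hG
  have hg0 : g ≠ 0 := by
    intro h
    have := hdvd _ hchar
    rw [h, zero_dvd_iff] at this
    exact ((Matrix.charpoly_monic M).map ι).ne_zero this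
  have hlc : g.leadingCoeff ≠ 0 := leadingCoeff_ne_zero.2 hg0
  have hmon : (G.map ι).Monic := by
    have h := congrArg leadingCoeff hG
    rw [leadingCoeff_mul, leadingCoeff_C] at h
    exact mul_right_cancel₀ hlc (by rw [h, one_mul])
  have hGm : G.Monic := Polynomial.monic_of_injective hι hmon
  have hGdvd : ∀ p, p ∈ I → G.map ι ∣ p := fun p hp =>
    (Dvd.intro _ hG).trans (hdvd p hp)
  have hGI : G.map ι ∈ I := by
    have : G.map ι = C (g.leadingCoeff)⁻¹ * g := by
      have h : C (g.leadingCoeff)⁻¹ * g = C (g.leadingCoeff)⁻¹ * (G.map ι * C g.leadingCoeff) := by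
        rw [hG]
      rw [h, mul_comm (G.map ι), ← mul_assoc, ← C_mul, inv_mul_cancel₀ hlc, C_1, one_mul]
    rw [this]
    exact I.mul_mem_left _ hgI
  have hsum : ∀ p : K[X], (aeval MK p).mulVec vK = p.sum fun k c => c • (MK ^ k).mulVec vK := by
    intro p
    rw [aeval_eq_sum_range, Matrix.sum_mulVec, Polynomial.sum_over_range _ (by simp)]
    simp [Matrix.smul_mulVec]
  refine ⟨G, hGm, ?_, ?_⟩
  · have h := (hI _).1 hGI
    funext i
    apply hι
    have h2 : aeval MK (G.map ι) = (aeval M G).map ι := by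
      rw [aeval_eq_sum_range, aeval_eq_sum_range, natDegree_map_eq_of_injective hι]
      ext a b
      simp only [Matrix.sum_apply, Matrix.smul_apply, Matrix.map_apply, map_sum, smul_eq_mul,
        map_mul, coeff_map, MK, ← map_pow]
      rfl
    rw [h2] at h
    rw [RingHom.map_mulVec ι (aeval M G) v i, show (aeval M G).map ι = _ from rfl]
    have := congrFun h i
    simpa [vK] using this
  · have hli : LinearIndependent K
        (fun j : Fin G.natDegree => (MK ^ (j : ℕ)).mulVec vK) := by
      rw [Fintype.linearIndependent_iff]
      intro c hc
      let p : K[X] := ∑ j : Fin G.natDegree, C (c j) * X ^ (j : ℕ)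
      have hp : p ∈ I := by
        rw [hI, ← hc]
        simp [p, Matrix.sum_mulVec, Matrix.smul_mulVec, ← Algebra.smul_def]
      have hdeg : p.degree < (G.map ι).degree := by
        rw [degree_eq_natDegree hmon.ne_zero, natDegree_map_eq_of_injective hι]
        exact degree_sum_fin_lt c
      have hp0 : p = 0 := Polynomial.eq_zero_of_dvd_of_degree_lt (hGdvd p hp) hdeg
      intro i
      have := congrArg (fun p => p.coeff (i : ℕ)) hp0
      simpa [p, coeff_C_mul, coeff_X_pow, Fin.val_inj] using this
    obtain ⟨L, hL⟩ : ∃ L : (Fin n → K) →ₗ[K] (Fin G.natDegree → K),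
        ∀ j : Fin G.natDegree, L ((MK ^ (j : ℕ)).mulVec vK) = Pi.single j 1 := by
      obtain ⟨L, hL⟩ := LinearMap.exists_leftInverse_of_injective
        (Fintype.linearCombination K (fun j : Fin G.natDegree => (MK ^ (j : ℕ)).mulVec vK))
        (LinearMap.ker_eq_bot.2 (linearIndependent_iff_injective_fintypeLinearCombination.1 hli))
      refine ⟨L, fun j => ?_⟩
      have := LinearMap.congr_fun hL (Pi.single j 1)
      simpa using this
    obtain ⟨b, hb⟩ := IsLocalization.exist_integer_multiples_of_finite (nonZeroDivisors R)
      (fun p : Fin G.natDegree × Fin n => L (Pi.single p.2 1) p.1)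
    choose N hN using hb
    refine ⟨b, nonZeroDivisors.ne_zero b.2, fun i k => N (i, k), fun i j => ?_⟩
    apply hι
    have h1 : L ((MK ^ (j : ℕ)).mulVec vK) i
        = ∑ k, (MK ^ (j : ℕ)).mulVec vK k * L (Pi.single k 1) i := by
      conv_lhs => rw [pi_eq_sum_univ' ((MK ^ (j : ℕ)).mulVec vK)]
      simp
    rw [hL, hpow] at h1
    have h2 : ∀ k, ι (N (i, k) * (M ^ (j : ℕ)).mulVec v k)
        = ι b * (ι ((M ^ (j : ℕ)).mulVec v k) * L (Pi.single k 1) i) := by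
      intro k
      have h3 : ι (N (i, k)) = ι b * L (Pi.single k 1) i := by
        have := hN (i, k)
        rwa [Algebra.smul_def] at this
      rw [map_mul, h3]
      ring
    rw [dotProduct, map_sum]
    simp only [h2, ← Finset.mul_sum]
    simp only [Function.comp_apply] at h1
    rw [← h1, Pi.single_apply]
    split_ifs <;> simp

namespace EuclideanJordanProduct

variable {W : Type*} [AddCommGroup W] [Module ℝ W]

/-- The powers `x ^ 0 = e`, `x ^ (k + 1) = x ∘ x ^ k`. -/
def pow (J : EuclideanJordanProduct W) (x : W) : ℕ → W
  | 0 => J.one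
  | k + 1 => J.mul x (J.pow x k)

/-- The degree of `x`: the least positive `k` such that `e, x, …, x ^ k` are linearly dependent. -/
noncomputable def degree (J : EuclideanJordanProduct W) (x : W) : ℕ :=
  sInf {k : ℕ | 0 < k ∧ ¬ LinearIndependent ℝ (fun j : Fin (k + 1) => J.pow x j)}

/-- The rank: the largest degree of an element. -/
noncomputable def rank (J : EuclideanJordanProduct W) : ℕ :=
  sSup (Set.range J.degree)

/-- The cone of squares. -/
def cone (J : EuclideanJordanProduct W) : Set W :=
  Set.range fun x => J.mul x x

/-- `χ` assigns to every `x` a monic real polynomial of degree `rank` that annihilates `x`, with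
coefficients that are polynomial functions of `x`. For an `x` of maximal degree, `χ x` is then the
minimal polynomial of `x`; such `x` are dense, so this determines `χ` when `W ≠ 0`. -/
structure IsCharPoly (J : EuclideanJordanProduct W) (χ : W → ℝ[X]) : Prop where
  monic : ∀ x, (χ x).Monic
  natDegree_eq : ∀ x, (χ x).natDegree = J.rank
  annihilates : ∀ x, ∑ k ∈ Finset.range (J.rank + 1), (χ x).coeff k • J.pow x k = 0
  polynomial : ∀ k, IsPolynomialFunction fun x => (χ x).coeff k

theorem exists_isCharPoly [FiniteDimensional ℝ W] (J : EuclideanJordanProduct W) :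
    ∃ χ : W → ℝ[X], J.IsCharPoly χ := by
  classical
  rcases subsingleton_or_nontrivial W with hW | hW
  · exact ⟨fun _ => X ^ J.rank, fun _ => monic_X_pow _, fun _ => natDegree_X_pow _,
      fun _ => Subsingleton.elim _ _,
      fun k => ⟨MvPolynomial.C ((X ^ J.rank : ℝ[X]).coeff k), fun x => by simp⟩⟩
  let b := Module.finBasis ℝ W
  let M : Matrix (Fin (Module.finrank ℝ W)) (Fin (Module.finrank ℝ W))
      (MvPolynomial (Fin (Module.finrank ℝ W)) ℝ) :=
    fun j k => ∑ i, MvPolynomial.X i * MvPolynomial.C (b.repr (J.mul (b i) (b k)) j)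
  let v : Fin (Module.finrank ℝ W) → MvPolynomial (Fin (Module.finrank ℝ W)) ℝ :=
    fun j => MvPolynomial.C (b.repr J.one j)
  let ev : W → MvPolynomial (Fin (Module.finrank ℝ W)) ℝ →+* ℝ :=
    fun x => MvPolynomial.eval (fun i => b.repr x i)
  have hmul : ∀ x y j, b.repr (J.mul x y) j = ∑ k, ev x (M j k) * b.repr y k := by
    intro x y j
    conv_lhs => rw [← b.sum_repr x, ← b.sum_repr y]
    simp only [map_sum, LinearMap.sum_apply, map_smul, LinearMap.smul_apply, Finsupp.coe_finsetSum,
      Finset.sum_apply, Finsupp.smul_apply, smul_eq_mul, M, ev, map_mul, MvPolynomial.eval_X,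
      MvPolynomial.eval_C, Finset.sum_mul, Finset.mul_sum]
    refine Finset.sum_congr rfl fun k _ => Finset.sum_congr rfl fun i _ => ?_
    ring
  have hpow : ∀ x k j, ev x (((M ^ k).mulVec v) j) = b.repr (J.pow x k) j := by
    intro x k
    induction k with
    | zero => intro j; simp [v, ev, pow]
    | succ k ih =>
      intro j
      rw [pow, hmul, pow_succ', ← Matrix.mulVec_mulVec]
      simp only [Matrix.mulVec, dotProduct, map_sum, map_mul] at ih ⊢
      simp only [ih]
  obtain ⟨G, hGm, hG0, q, hq, N, hN⟩ := exists_monic_krylov M v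
  have hann : ∀ x, ∑ k ∈ Finset.range (G.natDegree + 1), ev x (G.coeff k) • J.pow x k = 0 := by
    intro x
    apply b.ext_elem
    intro j
    have h := congrArg (ev x) (congrFun hG0 j)
    rw [aeval_eq_sum_range, Matrix.sum_mulVec] at h
    simp only [Matrix.smul_mulVec, Finset.sum_apply, Pi.smul_apply, smul_eq_mul, map_sum, map_mul,
      hpow, Pi.zero_apply, map_zero] at h
    simpa using h
  have hpos : 0 < G.natDegree := by
    rw [Nat.pos_iff_ne_zero]
    intro h
    have h1 : J.one = 0 := by
      have := hann 0
      rw [h] at this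
      simpa [hGm.natDegree_eq_zero.1 h, pow] using this
    obtain ⟨x, hx⟩ := exists_ne (0 : W)
    exact hx (by rw [← J.one_mul x, h1, map_zero, LinearMap.zero_apply])
  have hmem : ∀ x, G.natDegree ∈
      {k : ℕ | 0 < k ∧ ¬ LinearIndependent ℝ (fun j : Fin (k + 1) => J.pow x j)} := by
    intro x
    refine ⟨hpos, fun hli => ?_⟩
    have h := hann x
    rw [← Fin.sum_univ_eq_sum_range (fun k => ev x (G.coeff k) • J.pow x k)] at h
    have := Fintype.linearIndependent_iff.1 hli (fun k => ev x (G.coeff k)) h (Fin.last _)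
    simp [hGm.coeff_natDegree] at this
  obtain ⟨x₀, hx₀⟩ : ∃ x, ev x q ≠ 0 := by
    by_contra! h
    apply hq
    apply MvPolynomial.funext
    intro z
    have h1 := h (b.equivFun.symm z)
    have h2 : (fun i => b.repr (b.equivFun.symm z) i) = z := b.equivFun.apply_symm_apply z
    simp only [ev, h2] at h1
    rw [h1, map_zero]
  have hli : LinearIndependent ℝ (fun j : Fin G.natDegree => J.pow x₀ j) := by
    rw [Fintype.linearIndependent_iff]
    intro c hc i
    have h1 : ∑ j, c j * ev x₀ (N i ⬝ᵥ ((M ^ (j : ℕ)).mulVec v)) = 0 := by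
      have h2 : ∀ j : Fin G.natDegree, ev x₀ (N i ⬝ᵥ ((M ^ (j : ℕ)).mulVec v))
          = ∑ k, ev x₀ (N i k) * b.repr (J.pow x₀ j) k := by
        intro j
        simp only [dotProduct, map_sum, map_mul, hpow]
      simp only [h2, Finset.mul_sum]
      rw [Finset.sum_comm]
      refine Finset.sum_eq_zero fun k _ => ?_
      have h3 := congrArg (fun w => ev x₀ (N i k) * b.repr w k) hc
      simp only [map_sum, map_smul, Finsupp.coe_finsetSum, Finset.sum_apply, Finsupp.smul_apply,
        smul_eq_mul, map_zero, Finsupp.coe_zero, Pi.zero_apply, mul_zero, Finset.mul_sum] at h3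
      rw [← h3]
      exact Finset.sum_congr rfl fun j _ => by ring
    simp only [hN, apply_ite (ev x₀), map_zero, mul_ite, mul_zero, Finset.sum_ite_eq,
      Finset.mem_univ, if_true] at h1
    exact (mul_eq_zero.1 h1).resolve_right hx₀
  have hrank : J.rank = G.natDegree := by
    apply IsGreatest.csSup_eq
    refine ⟨⟨x₀, le_antisymm (Nat.sInf_le (hmem x₀)) (le_csInf ⟨_, hmem x₀⟩ ?_)⟩, ?_⟩
    · rintro k ⟨-, hk⟩
      by_contra! hlt
      exact hk (hli.comp (Fin.castLE hlt) (Fin.castLE_injective hlt))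
    · rintro _ ⟨x, rfl⟩
      exact Nat.sInf_le (hmem x)
  refine ⟨fun x => G.map (ev x), fun x => hGm.map _, fun x => ?_, fun x => ?_, fun k => ?_⟩
  · rw [hGm.natDegree_map, hrank]
  · simpa only [hrank, coeff_map] using hann x
  · refine ⟨MvPolynomial.rename (fun i => b.coord i) (G.coeff k), fun x => ?_⟩
    rw [MvPolynomial.eval_rename]
    exact coeff_map _ _

/-- The characteristic polynomial `χ_x(λ) = λ ^ r - a₁(x) λ ^ (r - 1) + ⋯ + (-1) ^ r a_r(x)`. -/
noncomputable def charPoly [FiniteDimensional ℝ W] (J : EuclideanJordanProduct W) : W → ℝ[X] :=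
  Classical.choose J.exists_isCharPoly

/-- The determinant `det x = a_r(x)`, the product of the roots of the characteristic polynomial. -/
noncomputable def det [FiniteDimensional ℝ W] (J : EuclideanJordanProduct W) (x : W) : ℝ :=
  (-1) ^ J.rank * (J.charPoly x).coeff 0

end EuclideanJordanProduct

/-- The convex combination `f y = ∑ i, β i * (rank i)⁻¹ * ln (det i y)` of the rank-normalized
log-determinants of `s` Euclidean Jordan products on `W`. -/
noncomputable def logDetCombination {W : Type*} [AddCommGroup W] [Module ℝ W]
    [FiniteDimensional ℝ W] {s : ℕ} (J : Fin s → EuclideanJordanProduct W) (β : Fin s → ℝ)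
    (y : W) : ℝ :=
  ∑ i, β i * ((J i).rank : ℝ)⁻¹ * Real.log ((J i).det y)

/-- The function `ψ_w y = ln ⟨∇f(y), w⟩`. -/
noncomputable def logGradientPairing {W : Type*} [NormedAddCommGroup W] [InnerProductSpace ℝ W]
    [FiniteDimensional ℝ W] (f : W → ℝ) (w : W) (y : W) : ℝ :=
  Real.log (inner ℝ (gradient f y) w)

/-! The core is a statement about one algebra: for `w` in the cone of squares, the derivative of
`log det` in direction `w` is log-convex in the base point (`logDetDeriv_le_rpow`). Hölder's
inequality (`sum_rpow_mul_rpow_le`) shows that positive combinations of log-convex functions are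
log-convex, and `⟨∇f, w⟩` is such a combination, so the `s` products never interact.

For one algebra, an automorphism of the cone that multiplies `det` by a constant moves the first
point to `e`; then `y₂ = ∑ a_j c_j` in a Jordan frame. At `s e + t y₂` the derivative is `∑ b_j / (s
+ t a_j)`, where `b_j = B(w, c_j) / B(c_j, c_j)` for the transported `w`. Here `b_j ≥ 0`, because a
square pairs nonnegatively with an idempotent. Weighted AM-GM, `a_j ^ t ≤ s + t a_j`, followed by
Hölder gives the bound.

This needs the theory of Jordan frames for a rank and a determinant defined abstractly. Elements
with `rank` independent powers have a frame by Lagrange interpolation; they are dense and the set of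
frames is compact, so every element has one (`exists_isFrame`). Differentiating `χ_x(x) = 0` gives
the derivative of `det` in a frame (`IsFrame.fderiv_det`). The automorphisms are `exp L(u)`, where
`L(u)` is multiplication by `u`: along this flow `det` grows by `exp (t tr u)`, so no eigenvalue
crosses zero and the cone is preserved (`flow_mem_cone`). -/

namespace EuclideanJordanProduct

/-! ### Jordan identities, power associativity and polynomial calculus. -/

section Algebra

variable {W : Type*} [AddCommGroup W] [Module ℝ W] (J : EuclideanJordanProduct W)

theorem mul_one (x : W) : J.mul x J.one = x := by
  rw [J.mul_comm, J.one_mul]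

/-- The Jordan identity, polarized in its cubic variable. -/
theorem jordan_polarized (x y z w : W) :
    J.mul (J.mul x y) (J.mul z w) + J.mul (J.mul y z) (J.mul x w)
        + J.mul (J.mul z x) (J.mul y w)
      = J.mul x (J.mul (J.mul y z) w) + J.mul y (J.mul (J.mul z x) w)
        + J.mul z (J.mul (J.mul x y) w) := by
  have h1 := J.jordan (x + y + z) w
  have h2 := J.jordan (x + y) w
  have h3 := J.jordan (y + z) w
  have h4 := J.jordan (z + x) w
  have h5 := J.jordan x w
  have h6 := J.jordan y w
  have h7 := J.jordan z w
  simp only [map_add, LinearMap.add_apply] at h1 h2 h3 h4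
  rw [J.mul_comm y x, J.mul_comm z y, J.mul_comm x z] at *
  have h : (2 : ℝ) • (J.mul (J.mul x y) (J.mul z w) + J.mul (J.mul y z) (J.mul x w)
        + J.mul (J.mul z x) (J.mul y w))
      = (2 : ℝ) • (J.mul x (J.mul (J.mul y z) w) + J.mul y (J.mul (J.mul z x) w)
        + J.mul z (J.mul (J.mul x y) w)) := by
    -- Inclusion-exclusion isolates the trilinear part of the cubic identity, which is twice the
    -- claim.
    linear_combination (norm := module) h1 - h2 - h3 - h4 + h5 + h6 + h7
  exact smul_right_injective W (two_ne_zero (α := ℝ)) h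

/-- Multiplication by a triple product in terms of shorter multiplications. -/
theorem mul_mul_mul_apply (x y z w : W) :
    J.mul (J.mul x (J.mul y z)) w
      = J.mul x (J.mul (J.mul y z) w) + J.mul y (J.mul (J.mul z x) w)
        + J.mul z (J.mul (J.mul x y) w) - J.mul y (J.mul x (J.mul z w))
        - J.mul z (J.mul x (J.mul y w)) := by
  have h1 := J.jordan_polarized x y z w
  -- The left side of the polarized identity is symmetric in `x` and `w`, so the right sides of
  -- these two instances agree.
  have h2 := J.jordan_polarized w y z x
  have e1 : J.mul (J.mul w y) (J.mul z x) = J.mul (J.mul z x) (J.mul y w) := by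
    rw [J.mul_comm w y, J.mul_comm]
  have e2 : J.mul (J.mul y z) (J.mul w x) = J.mul (J.mul y z) (J.mul x w) := by
    rw [J.mul_comm w x]
  have e3 : J.mul (J.mul z w) (J.mul y x) = J.mul (J.mul x y) (J.mul z w) := by
    rw [J.mul_comm y x, J.mul_comm]
  have e4 : J.mul w (J.mul (J.mul y z) x) = J.mul (J.mul x (J.mul y z)) w := by
    rw [J.mul_comm w, J.mul_comm x]
  have e5 : J.mul y (J.mul (J.mul z w) x) = J.mul y (J.mul x (J.mul z w)) := by
    rw [J.mul_comm x]
  have e6 : J.mul z (J.mul (J.mul w y) x) = J.mul z (J.mul x (J.mul y w)) := by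
    rw [J.mul_comm x, J.mul_comm w y]
  rw [e1, e2, e3, e4, e5, e6] at h2
  linear_combination (norm := module) h1 - h2

/-- The triple product formula expresses `L(x ^ (n + 2))` through `L(x)`, `L(x ^ 2)`, `L(x ^ n)` and
`L(x ^ (n + 1))`. Since `L(x ^ 2)` occurs there, commutation with it is carried through the
induction as well. -/
theorem commute_mul_pow (x : W) (n : ℕ) :
    (∀ w, J.mul x (J.mul (J.pow x n) w) = J.mul (J.pow x n) (J.mul x w)) ∧
      ∀ w, J.mul (J.mul x x) (J.mul (J.pow x n) w)
        = J.mul (J.pow x n) (J.mul (J.mul x x) w) := by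
  induction n using Nat.strong_induction_on with
  | _ n ih =>
  match n with
  | 0 => simp [pow, J.one_mul]
  | 1 => simp [pow, J.mul_one, J.jordan]
  | n + 2 =>
    obtain ⟨a0, a1⟩ := ih n (by omega)
    obtain ⟨b0, b1⟩ := ih (n + 1) (by omega)
    have hj := fun w => J.jordan x w
    have key : ∀ w, J.mul (J.pow x (n + 2)) w
        = (2 : ℝ) • J.mul x (J.mul (J.pow x (n + 1)) w)
          + J.mul (J.pow x n) (J.mul (J.mul x x) w)
          - (2 : ℝ) • J.mul x (J.mul x (J.mul (J.pow x n) w)) := by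
      intro w
      have h := J.mul_mul_mul_apply x x (J.pow x n) w
      have e : J.mul (J.pow x n) x = J.pow x (n + 1) := J.mul_comm _ _
      rw [e, ← a0, ← a0] at h
      change J.mul (J.mul x (J.mul x (J.pow x n))) w = _
      rw [h, show J.mul x (J.pow x n) = J.pow x (n + 1) from rfl]
      module
    constructor
    · intro w
      rw [key, key]
      simp only [map_add, map_sub, map_smul, ← a0, ← b0, hj, ← a1]
    · intro w
      rw [key, key]
      simp only [map_add, map_sub, map_smul, hj, ← a1, ← b1]

theorem pow_eq (x : W) (n : ℕ) :
    J.pow x n = ((J.mul x : Module.End ℝ W) ^ n) J.one := by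
  induction n with
  | zero => rfl
  | succ n ih => rw [pow, ih, _root_.pow_succ', Module.End.mul_apply]

/-- The value `p(x)` of a real polynomial at an element. -/
noncomputable def evalPoly (x : W) (p : ℝ[X]) : W :=
  aeval (J.mul x : Module.End ℝ W) p J.one

theorem evalPoly_eq_sum (x : W) (p : ℝ[X]) {n : ℕ} (h : p.natDegree < n) :
    J.evalPoly x p = ∑ k ∈ Finset.range n, p.coeff k • J.pow x k := by
  rw [evalPoly, aeval_eq_sum_range' h, LinearMap.sum_apply]
  simp [pow_eq]

theorem evalPoly_add (x : W) (p q : ℝ[X]) :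
    J.evalPoly x (p + q) = J.evalPoly x p + J.evalPoly x q := by
  simp [evalPoly]

theorem evalPoly_sum {ι : Type*} (s : Finset ι) (x : W) (p : ι → ℝ[X]) :
    J.evalPoly x (∑ i ∈ s, p i) = ∑ i ∈ s, J.evalPoly x (p i) := by
  simp [evalPoly]

theorem evalPoly_C_mul (x : W) (a : ℝ) (p : ℝ[X]) :
    J.evalPoly x (C a * p) = a • J.evalPoly x p := by
  simp [evalPoly, ← Algebra.smul_def]

theorem evalPoly_one (x : W) : J.evalPoly x 1 = J.one := by
  simp [evalPoly]

theorem evalPoly_X (x : W) : J.evalPoly x X = x := by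
  simp [evalPoly, J.mul_one]

/-- Power associativity: `L(q(x))` commutes with `L(x)`, hence with `p(L(x))`; apply both orders to
`e`. -/
theorem evalPoly_mul (x : W) (p q : ℝ[X]) :
    J.evalPoly x (p * q) = J.mul (J.evalPoly x p) (J.evalPoly x q) := by
  have h : Commute (J.mul x : Module.End ℝ W) (J.mul (J.evalPoly x q)) := by
    apply LinearMap.ext
    intro w
    rw [Module.End.mul_apply, Module.End.mul_apply, J.evalPoly_eq_sum x q (Nat.lt_succ_self _)]
    simp only [map_sum, map_smul, LinearMap.sum_apply, LinearMap.smul_apply,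
      (J.commute_mul_pow x _).1]
  have h2 : Commute (aeval (J.mul x : Module.End ℝ W) p) (J.mul (J.evalPoly x q)) := by
    induction p using Polynomial.induction_on' with
    | add p q hp hq => rw [map_add]; exact hp.add_left hq
    | monomial n a =>
      rw [aeval_monomial]
      exact Commute.mul_left (Algebra.commute_algebraMap_left a _) (h.pow_left n)
  have h3 := LinearMap.congr_fun h2.eq J.one
  rw [Module.End.mul_apply, Module.End.mul_apply, J.mul_one] at h3
  rw [J.mul_comm, evalPoly, map_mul, Module.End.mul_apply]
  exact h3

/-- Multiplication by an idempotent is positive semidefinite for an associative form. -/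
theorem inner_mul_idempotent_nonneg {B : W →ₗ[ℝ] W →ₗ[ℝ] ℝ} (hp : ∀ x, x ≠ 0 → 0 < B x x)
    (ha : ∀ x y z, B x (J.mul y z) = B (J.mul x y) z) {c : W} (hc : J.mul c c = c) (v : W) :
    0 ≤ B (J.mul v v) c := by
  have hp' : ∀ x, 0 ≤ B x x := fun x => by
    rcases eq_or_ne x 0 with rfl | h
    · simp
    · exact (hp x h).le
  -- Peirce relation `2 L ^ 3 - 3 L ^ 2 + L = 0` for `L = L(c)`: the only possible eigenvalues are
  -- `0`, `1/2`, `1`.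
  have h3 : ∀ w, J.mul c (J.mul c (J.mul c w))
      = (1 / 2 : ℝ) • ((3 : ℝ) • J.mul c (J.mul c w) - J.mul c w) := by
    intro w
    have h := J.mul_mul_mul_apply c c c w
    rw [hc, hc] at h
    linear_combination (norm := module) (1 / 2 : ℝ) • h
  have hsym : ∀ x y, B (J.mul c x) y = B x (J.mul c y) := fun x y => by
    rw [ha, J.mul_comm]
  -- On `{0, 1/2, 1}` one has `λ = λ ^ 2 + 4 (λ - λ ^ 2) ^ 2`, which writes `L(c)` as a sum of
  -- squares of symmetric operators.
  have key : B (J.mul v v) c = B (J.mul c v) (J.mul c v)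
      + 4 * B (J.mul c v - J.mul c (J.mul c v)) (J.mul c v - J.mul c (J.mul c v)) := by
    rw [← ha, J.mul_comm v c]
    simp only [map_sub, LinearMap.sub_apply, hsym, h3, map_smul, smul_eq_mul]
    ring
  rw [key]
  have := hp' (J.mul c v)
  have := hp' (J.mul c v - J.mul c (J.mul c v))
  positivity

end Algebra
end EuclideanJordanProduct

/-! ### Spectral theorem. -/

/-- An operator that is symmetric for some positive definite form is annihilated by a product of
distinct real linear factors. -/
theorem exists_finset_prod_X_sub_C_annihilates {V : Type*} [AddCommGroup V] [Module ℝ V]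
    [FiniteDimensional ℝ V] (B : V →ₗ[ℝ] V →ₗ[ℝ] ℝ) (hs : ∀ x y, B x y = B y x)
    (hp : ∀ x, x ≠ 0 → 0 < B x x) (T : Module.End ℝ V) (hT : ∀ x y, B (T x) y = B x (T y)) :
    ∃ s : Finset ℝ, aeval T (∏ a ∈ s, (X - C a)) = 0 := by
  classical
  let core : InnerProductSpace.Core ℝ V :=
    { inner := fun x y => B x y
      conj_inner_symm := fun x y => hs y x
      re_inner_nonneg := fun x => by
        rcases eq_or_ne x 0 with rfl | h
        · simp
        · exact (hp x h).le
      add_left := fun x y z => by simp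
      smul_left := fun x y r => by simp
      definite := fun x h => by
        by_contra hx
        exact (hp x hx).ne' h }
  let : NormedAddCommGroup V := core.toNormedAddCommGroup
  let : InnerProductSpace ℝ V := InnerProductSpace.ofCore core.toCore
  have hsym : T.IsSymmetric := fun x y => hT x y
  let b := hsym.eigenvectorBasis rfl
  let μ := hsym.eigenvalues rfl
  refine ⟨Finset.univ.image μ, ?_⟩
  apply b.toBasis.ext
  intro i
  have hi : T (b i) = μ i • b i := hsym.apply_eigenvectorBasis rfl i
  have : (Finset.univ.image μ).prod (fun a => X - C a)
      = (∏ a ∈ (Finset.univ.image μ).erase (μ i), (X - C a)) * (X - C (μ i)) := by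
    rw [Finset.prod_erase_mul _ _ (Finset.mem_image_of_mem _ (Finset.mem_univ i))]
  rw [this, map_mul, Module.End.mul_apply]
  simp [hi, Algebra.algebraMap_eq_smul_one]

namespace EuclideanJordanProduct

section Algebra

variable {W : Type*} [AddCommGroup W] [Module ℝ W] (J : EuclideanJordanProduct W)

/-- Distinct linear factors are coprime, so their product, which annihilates `x`, divides `p - q`.
-/
theorem evalPoly_eq_of_eval_eq {x : W} {s : Finset ℝ}
    (hs : J.evalPoly x (∏ a ∈ s, (X - C a)) = 0) {p q : ℝ[X]}
    (h : ∀ a ∈ s, p.eval a = q.eval a) : J.evalPoly x p = J.evalPoly x q := by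
  have hdvd : (∏ a ∈ s, (X - C a)) ∣ p - q := by
    apply Finset.prod_dvd_of_coprime
    · intro a _ b _ hab
      exact pairwise_coprime_X_sub_C (fun _ _ h => h) hab
    · intro a ha
      rw [dvd_iff_isRoot, IsRoot, eval_sub, h a ha, sub_self]
  obtain ⟨g, hg⟩ := hdvd
  have : p = (∏ a ∈ s, (X - C a)) * g + q := by rw [← hg]; ring
  rw [this, evalPoly_add, evalPoly_mul, hs, map_zero, LinearMap.zero_apply, zero_add]

/-- The spectral theorem: every element is a combination of orthogonal nonzero idempotents with
distinct coefficients. -/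
theorem exists_spectral_decomposition [FiniteDimensional ℝ W] (x : W) :
    ∃ (s : Finset ℝ) (c : ℝ → W), (∀ a ∈ s, c a ≠ 0) ∧
      (∀ a ∈ s, ∀ b ∈ s, J.mul (c a) (c b) = if a = b then c a else 0) ∧
      ∑ a ∈ s, c a = J.one ∧ ∑ a ∈ s, a • c a = x ∧
      J.evalPoly x (∏ a ∈ s, (X - C a)) = 0 := by
  classical
  obtain ⟨B, hs, hp, ha⟩ := J.exists_inner
  obtain ⟨s₀, hs₀⟩ := exists_finset_prod_X_sub_C_annihilates B hs hp (J.mul x)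
    fun y z => by rw [J.mul_comm, ha]
  -- The annihilating set of roots is taken of least cardinality; otherwise some of the idempotents
  -- below could vanish.
  have hex : ∃ n, ∃ s : Finset ℝ, s.card = n ∧ J.evalPoly x (∏ a ∈ s, (X - C a)) = 0 :=
    ⟨_, s₀, rfl, by rw [evalPoly, hs₀, LinearMap.zero_apply]⟩
  obtain ⟨s, hcard, h0⟩ := Nat.find_spec hex
  have hmin : ∀ t : Finset ℝ, J.evalPoly x (∏ a ∈ t, (X - C a)) = 0 → s.card ≤ t.card :=
    fun t ht => hcard ▸ Nat.find_min' hex ⟨t, rfl, ht⟩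
  -- Lagrange basis polynomials on `s`. Every relation between the idempotents `ℓ_a(x)` is then
  -- checked at the points of `s`.
  let ℓ : ℝ → ℝ[X] := fun a =>
    C (∏ b ∈ s.erase a, (a - b))⁻¹ * ∏ b ∈ s.erase a, (X - C b)
  have hne : ∀ a, ∏ b ∈ s.erase a, (a - b) ≠ 0 := fun a =>
    Finset.prod_ne_zero_iff.2 fun b hb => sub_ne_zero.2 (Finset.ne_of_mem_erase hb).symm
  have hℓ : ∀ a ∈ s, ∀ b ∈ s, (ℓ a).eval b = if b = a then 1 else 0 := by
    intro a _ b hb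
    simp only [ℓ, eval_mul, eval_C, eval_prod, eval_sub, eval_X]
    split_ifs with h
    · subst h
      exact inv_mul_cancel₀ (hne b)
    · rw [Finset.prod_eq_zero (Finset.mem_erase.2 ⟨h, hb⟩) (sub_self b), mul_zero]
  refine ⟨s, fun a => J.evalPoly x (ℓ a), ?_, ?_, ?_, ?_, h0⟩
  · intro a has h
    simp only [ℓ, evalPoly_C_mul, smul_eq_zero] at h
    have := hmin _ (h.resolve_left (inv_ne_zero (hne a)))
    exact absurd this (not_le.2 (Finset.card_erase_lt_of_mem has))
  · intro a has b hb
    rw [← evalPoly_mul]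
    split_ifs with hab
    · subst hab
      refine J.evalPoly_eq_of_eval_eq h0 fun d hd => ?_
      rw [eval_mul, hℓ a has d hd]
      split_ifs <;> simp
    · rw [J.evalPoly_eq_of_eval_eq h0 (q := 0), evalPoly, map_zero, LinearMap.zero_apply]
      intro d hd
      rw [eval_mul, hℓ a has d hd, hℓ b hb d hd, eval_zero]
      split_ifs with h1 h2 <;> simp
      exact hab (h1.symm.trans h2)
  · rw [← evalPoly_sum, J.evalPoly_eq_of_eval_eq h0 (q := 1), evalPoly_one]
    intro d hd
    rw [eval_finsetSum, Finset.sum_congr rfl fun a ha => hℓ a ha d hd]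
    simp [hd]
  · simp only [← evalPoly_C_mul]
    rw [← evalPoly_sum, J.evalPoly_eq_of_eval_eq h0 (q := X), evalPoly_X]
    intro d hd
    rw [eval_finsetSum]
    simp only [eval_mul, eval_C]
    rw [Finset.sum_congr rfl fun a ha => by rw [hℓ a ha d hd]]
    simp [hd]

/-! ### Jordan frames and elements of maximal degree. -/

/-- A Jordan frame: a complete system of `rank` orthogonal nonzero idempotents. -/
structure IsFrame (c : Fin J.rank → W) : Prop where
  ne_zero : ∀ i, c i ≠ 0
  mul_eq : ∀ i j, J.mul (c i) (c j) = if i = j then c i else 0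
  sum_eq : ∑ i, c i = J.one

variable {J} {c : Fin J.rank → W}

theorem IsFrame.sum_mul_sum (hc : J.IsFrame c) (a b : Fin J.rank → ℝ) :
    J.mul (∑ i, a i • c i) (∑ i, b i • c i) = ∑ i, (a i * b i) • c i := by
  simp [hc.mul_eq, smul_smul, _root_.mul_comm]

theorem IsFrame.sum_mul (hc : J.IsFrame c) (a : Fin J.rank → ℝ) (j : Fin J.rank) :
    J.mul (∑ i, a i • c i) (c j) = a j • c j := by
  simp [hc.mul_eq]

theorem IsFrame.pow_sum (hc : J.IsFrame c) (a : Fin J.rank → ℝ) (n : ℕ) :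
    J.pow (∑ i, a i • c i) n = ∑ i, a i ^ n • c i := by
  induction n with
  | zero => simp [pow, hc.sum_eq]
  | succ n ih => rw [pow, ih, hc.sum_mul_sum]; simp only [pow_succ']

theorem IsFrame.sum_smul_injective (hc : J.IsFrame c) {a b : Fin J.rank → ℝ}
    (h : ∑ i, a i • c i = ∑ i, b i • c i) : a = b := by
  funext j
  have h1 := congrArg (fun x => J.mul x (c j)) h
  simp only [hc.sum_mul] at h1
  exact smul_left_injective ℝ (hc.ne_zero j) h1

variable (J)

theorem one_ne_zero [Nontrivial W] : J.one ≠ 0 := by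
  intro h
  obtain ⟨x, hx⟩ := exists_ne (0 : W)
  exact hx (by rw [← J.one_mul x, h, map_zero, LinearMap.zero_apply])

theorem exists_linearIndependent_pow [FiniteDimensional ℝ W] [Nontrivial W] :
    0 < J.rank ∧ ∃ x, LinearIndependent ℝ fun j : Fin J.rank => J.pow x j := by
  have hmem : ∀ x, (Module.finrank ℝ W) ∈
      {k : ℕ | 0 < k ∧ ¬ LinearIndependent ℝ (fun j : Fin (k + 1) => J.pow x j)} := by
    refine fun x => ⟨Module.finrank_pos, fun h => ?_⟩
    have := h.fintype_card_le_finrank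
    simp at this
  have hdeg : ∀ x, 0 < J.degree x := fun x => (Nat.sInf_mem ⟨_, hmem x⟩).1
  obtain ⟨x, hx⟩ : J.rank ∈ Set.range J.degree :=
    Nat.sSup_mem (Set.range_nonempty _) ⟨Module.finrank ℝ W, by
      rintro _ ⟨x, rfl⟩
      exact Nat.sInf_le (hmem x)⟩
  refine ⟨hx ▸ hdeg x, x, ?_⟩
  rw [← hx]
  obtain ⟨m, hm⟩ := Nat.exists_eq_succ_of_ne_zero (hdeg x).ne'
  -- The degree is an infimum over positive `k`, so at degree `1` minimality gives nothing and `e ≠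
  -- 0` is used instead.
  rcases Nat.eq_zero_or_pos m with rfl | hm0
  · rw [hm]
    rw [linearIndependent_unique_iff]
    exact J.one_ne_zero
  · by_contra h
    rw [hm] at h
    have : J.degree x ≤ m := Nat.sInf_le ⟨hm0, h⟩
    omega

theorem charPoly_spec [FiniteDimensional ℝ W] : J.IsCharPoly J.charPoly :=
  Classical.choose_spec J.exists_isCharPoly

theorem evalPoly_charPoly [FiniteDimensional ℝ W] (x : W) : J.evalPoly x (J.charPoly x) = 0 := by
  rw [J.evalPoly_eq_sum x _ (Nat.lt_succ_self _), J.charPoly_spec.natDegree_eq]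
  exact J.charPoly_spec.annihilates x

variable {J} in
theorem IsFrame.evalPoly_sum (hc : J.IsFrame c) (a : Fin J.rank → ℝ) (p : ℝ[X]) :
    J.evalPoly (∑ i, a i • c i) p = ∑ i, p.eval (a i) • c i := by
  rw [J.evalPoly_eq_sum _ p (Nat.lt_succ_self _)]
  simp only [hc.pow_sum, Finset.smul_sum, smul_smul]
  rw [Finset.sum_comm]
  simp only [← Finset.sum_smul, eval_eq_sum_range]

variable {J} in
-- Annihilation forces each `a i` to be a root; `rank` distinct roots determine a monic polynomial
-- of degree `rank`.
theorem IsFrame.charPoly_of_injective [FiniteDimensional ℝ W] (hc : J.IsFrame c)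
    {a : Fin J.rank → ℝ} (ha : Function.Injective a) :
    J.charPoly (∑ i, a i • c i) = ∏ i, (X - C (a i)) := by
  have h := J.evalPoly_charPoly (∑ i, a i • c i)
  rw [hc.evalPoly_sum] at h
  have h0 := hc.sum_smul_injective (b := 0) (h.trans (by simp))
  apply eq_of_monic_of_dvd_of_natDegree_le (monic_prod_X_sub_C _ _) (J.charPoly_spec.monic _)
  · apply Finset.prod_dvd_of_coprime
    · intro i _ j _ hij
      exact pairwise_coprime_X_sub_C ha hij
    · intro i _
      rw [dvd_iff_isRoot]
      exact congrFun h0 i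
  · rw [J.charPoly_spec.natDegree_eq, natDegree_prod_of_monic _ _ fun i _ => monic_X_sub_C _]
    simp

/-- An element whose first `rank` powers are independent has a frame of eigen-idempotents. -/
theorem exists_isFrame_of_linearIndependent [FiniteDimensional ℝ W] {x : W}
    (hx : LinearIndependent ℝ fun j : Fin J.rank => J.pow x j) :
    ∃ (c : Fin J.rank → W) (a : Fin J.rank → ℝ), J.IsFrame c ∧ x = ∑ i, a i • c i := by
  classical
  obtain ⟨s, c, hc0, hcm, hc1, hcx, hs⟩ := J.exists_spectral_decomposition x
  have hmonic : (∏ a ∈ s, (X - C a)).Monic := monic_prod_of_monic _ _ fun a _ => monic_X_sub_C a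
  have hnd : (∏ a ∈ s, (X - C a)).natDegree = s.card := by
    rw [natDegree_prod_of_monic _ _ fun a _ => monic_X_sub_C a]; simp
  -- Fewer points would give an annihilator of degree below `rank`. Conversely, every point of `s`
  -- is a root of the characteristic polynomial, which bounds `s.card` by `rank`.
  have hle : J.rank ≤ s.card := by
    by_contra! hlt
    rw [J.evalPoly_eq_sum x _ (hnd ▸ hlt),
      ← Fin.sum_univ_eq_sum_range (fun k => (∏ a ∈ s, (X - C a) : ℝ[X]).coeff k • J.pow x k)] at hs
    have := Fintype.linearIndependent_iff.1 hx _ hs ⟨s.card, hlt⟩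
    simp only [← hnd, hmonic.coeff_natDegree] at this
    norm_num at this
  have hev : ∀ p : ℝ[X], J.evalPoly x p = ∑ a ∈ s, p.eval a • c a := by
    intro p
    have hpow : ∀ n, J.pow x n = ∑ a ∈ s, a ^ n • c a := by
      intro n
      induction n with
      | zero => simp [pow, hc1]
      | succ n ih =>
        rw [pow, ih]
        nth_rewrite 1 [← hcx]
        simp only [map_sum, map_smul, LinearMap.sum_apply, LinearMap.smul_apply]
        refine Finset.sum_congr rfl fun a ha => ?_
        rw [Finset.sum_congr rfl fun b hb => by rw [hcm b hb a ha]]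
        simp [ha, smul_smul, pow_succ]
    rw [J.evalPoly_eq_sum x p (Nat.lt_succ_self _)]
    simp only [hpow, Finset.smul_sum, smul_smul]
    rw [Finset.sum_comm]
    simp only [← Finset.sum_smul, eval_eq_sum_range]
  have hge : s.card ≤ J.rank := by
    rw [← J.charPoly_spec.natDegree_eq x]
    refine Polynomial.card_le_degree_of_subset_roots (Z := s) fun a ha => ?_
    rw [mem_roots (J.charPoly_spec.monic x).ne_zero]
    have h := J.evalPoly_charPoly x
    rw [hev] at h
    have h2 := congrArg (fun y => J.mul y (c a)) h
    simp only [map_sum, map_smul, LinearMap.sum_apply, LinearMap.smul_apply, map_zero,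
      LinearMap.zero_apply] at h2
    rw [Finset.sum_congr rfl fun b hb => by rw [hcm b hb a ha]] at h2
    simp only [smul_ite, smul_zero, Finset.sum_ite_eq', show a ∈ s from ha, if_true] at h2
    exact (smul_eq_zero.1 h2).resolve_right (hc0 a ha)
  have hcard : Fintype.card (Fin J.rank) = Fintype.card s := by
    simp [le_antisymm hle hge]
  let e : Fin J.rank ≃ s := Fintype.equivOfCardEq hcard
  refine ⟨fun i => c (e i), fun i => e i, ⟨fun i => hc0 _ (e i).2, fun i j => ?_, ?_⟩, ?_⟩
  · rw [hcm _ (e i).2 _ (e j).2]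
    simp
  · rw [e.sum_comp fun a : s => c a, ← hc1, Finset.sum_coe_sort]
  · rw [e.sum_comp fun a : s => (a : ℝ) • c a, Finset.sum_coe_sort s fun a => a • c a, hcx]

end Algebra
end EuclideanJordanProduct

/-! ### Analyticity, density and compactness: a frame for every element. -/

theorem IsPolynomialFunction.analyticAt {W : Type*} [NormedAddCommGroup W] [NormedSpace ℝ W]
    [FiniteDimensional ℝ W] {g : W → ℝ} (hg : IsPolynomialFunction g) (x : W) :
    AnalyticAt ℝ g x := by
  obtain ⟨p, hp⟩ := hg
  rw [funext hp]
  exact AnalyticAt.aeval_mvPolynomial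
    (fun ℓ => (LinearMap.toContinuousLinearMap (ℓ : W →ₗ[ℝ] ℝ)).analyticAt x) p

/-- The shift separates equal coordinates for every `t ≠ 0`, and a small `t` keeps distinct ones
apart. -/
theorem eventually_injective_add_smul {n : ℕ} (a : Fin n → ℝ) :
    ∀ᶠ t : ℝ in nhdsWithin 0 {0}ᶜ, Function.Injective fun i => a i + t * (i : ℝ) := by
  have h : ∀ i j : Fin n, i ≠ j →
      ∀ᶠ t : ℝ in nhdsWithin 0 {0}ᶜ, a i + t * (i : ℝ) ≠ a j + t * (j : ℝ) := by
    intro i j hij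
    have hij' : (i : ℝ) - j ≠ 0 := by
      rw [sub_ne_zero]
      exact_mod_cast fun h => hij (Fin.ext h)
    rcases eq_or_ne (a i) (a j) with h | h
    · filter_upwards [self_mem_nhdsWithin] with t ht he
      rw [h] at he
      exact mul_ne_zero ht hij' (by linarith)
    · refine Filter.Eventually.filter_mono nhdsWithin_le_nhds ?_
      have hc : ∀ i : Fin n, ContinuousAt (fun t : ℝ => a i + t * (i : ℝ)) 0 := fun i => by fun_prop
      exact ((hc i).ne_iff_eventually_ne (hc j)).1 (by simpa using h)
  have h2 := Filter.eventually_all.2 fun i => Filter.eventually_all.2 fun j =>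
    Filter.eventually_imp_distrib_left.2 (h i j)
  filter_upwards [h2] with t ht i j he
  by_contra hij
  exact ht i j hij he

/-- Two continuous functions on `ℝⁿ` that agree at the points with distinct coordinates are equal. -/
theorem eq_of_eq_on_injective {n : ℕ} {f g : (Fin n → ℝ) → ℝ} (hf : Continuous f)
    (hg : Continuous g) (h : ∀ a, Function.Injective a → f a = g a) (a : Fin n → ℝ) :
    f a = g a := by
  have hc : Continuous fun t : ℝ => fun i : Fin n => a i + t * (i : ℝ) := by fun_prop
  have hl : ∀ f : (Fin n → ℝ) → ℝ, Continuous f → Filter.Tendsto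
      (fun t : ℝ => f fun i : Fin n => a i + t * (i : ℝ)) (nhdsWithin 0 {0}ᶜ) (nhds (f a)) := by
    intro f hf
    have := (hf.comp hc).tendsto 0
    simp only [Function.comp_apply, zero_mul, add_zero] at this
    exact this.mono_left nhdsWithin_le_nhds
  refine tendsto_nhds_unique ((hl f hf).congr' ?_) (hl g hg)
  filter_upwards [eventually_injective_add_smul a] with t ht
  exact h _ ht

namespace EuclideanJordanProduct

variable {W : Type*} [NormedAddCommGroup W] [NormedSpace ℝ W] [FiniteDimensional ℝ W]
  (J : EuclideanJordanProduct W)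

/-- The product as a continuous bilinear map. -/
noncomputable def mulL : W →L[ℝ] W →L[ℝ] W :=
  LinearMap.toContinuousBilinearMap J.mul

theorem mulL_apply (x y : W) : J.mulL x y = J.mul x y := rfl

theorem analyticAt_pow (n : ℕ) (x : W) : AnalyticAt ℝ (fun y => J.pow y n) x := by
  induction n with
  | zero => exact analyticAt_const
  | succ n ih =>
    simp only [pow, ← mulL_apply]
    exact (J.mulL.analyticAt_bilinear _).comp₂ analyticAt_id ih

theorem analyticAt_charPoly_coeff (k : ℕ) (x : W) :
    AnalyticAt ℝ (fun y => (J.charPoly y).coeff k) x :=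
  (J.charPoly_spec.polynomial k).analyticAt x

theorem continuous_charPoly_coeff (k : ℕ) : Continuous fun y => (J.charPoly y).coeff k :=
  continuous_iff_continuousAt.2 fun x => (J.analyticAt_charPoly_coeff k x).continuousAt

/-- Elements whose first `rank` powers are independent are dense. -/
theorem dense_linearIndependent_pow [Nontrivial W] :
    Dense {x : W | LinearIndependent ℝ fun j : Fin J.rank => J.pow x j} := by
  classical
  obtain ⟨-, x₀, hx₀⟩ := J.exists_linearIndependent_pow
  obtain ⟨Φ, hΦ⟩ : ∃ Φ : W →ₗ[ℝ] (Fin J.rank → ℝ),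
      ∀ j : Fin J.rank, Φ (J.pow x₀ j) = Pi.single j 1 := by
    obtain ⟨L, hL⟩ := LinearMap.exists_leftInverse_of_injective
      (Fintype.linearCombination ℝ (fun j : Fin J.rank => J.pow x₀ j))
      (LinearMap.ker_eq_bot.2 (linearIndependent_iff_injective_fintypeLinearCombination.1 hx₀))
    refine ⟨L, fun j => ?_⟩
    have := LinearMap.congr_fun hL (Pi.single j 1)
    simpa using this
  -- `D` is analytic, equals `1` at `x₀`, and where it is nonzero the powers are independent. By the
  -- identity theorem it vanishes on no open set.
  let D : W → ℝ := fun x => (Matrix.of fun j i : Fin J.rank => Φ (J.pow x j) i).det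
  have hD : AnalyticOnNhd ℝ D Set.univ := by
    intro x _
    simp only [D, Matrix.det_apply', Matrix.of_apply]
    refine Finset.analyticAt_fun_sum _ fun σ _ => ?_
    refine analyticAt_const.mul ?_
    refine Finset.analyticAt_fun_prod _ fun i _ => ?_
    exact ((LinearMap.toContinuousLinearMap ((LinearMap.proj i).comp Φ)).analyticAt _).comp
      (J.analyticAt_pow _ x)
  have hD0 : D x₀ = 1 := by
    have : (Matrix.of fun j i : Fin J.rank => Φ (J.pow x₀ j) i) = 1 := by
      ext j i
      simp [hΦ, Matrix.one_apply, Pi.single_apply, eq_comm]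
    simp only [D, this, Matrix.det_one]
  have hli : ∀ x, D x ≠ 0 → LinearIndependent ℝ fun j : Fin J.rank => J.pow x j := by
    intro x hx
    have h1 : LinearIndependent ℝ (fun j : Fin J.rank => Φ (J.pow x j)) :=
      Matrix.linearIndependent_rows_of_det_ne_zero hx
    exact LinearIndependent.of_comp Φ h1
  intro x
  rw [mem_closure_iff_frequently]
  intro hx
  have h0 : D =ᶠ[nhds x] 0 := by
    filter_upwards [hx] with y hy
    by_contra h
    exact hy (hli y h)
  have := hD.eqOn_zero_of_preconnected_of_eventuallyEq_zero isPreconnected_univ (Set.mem_univ x) h0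
    (Set.mem_univ x₀)
  rw [hD0] at this
  norm_num at this

theorem exists_norm_le_of_form {B : W →ₗ[ℝ] W →ₗ[ℝ] ℝ} (hp : ∀ x, x ≠ 0 → 0 < B x x) :
    ∃ a, 0 < a ∧ ∀ x, a * ‖x‖ ^ 2 ≤ B x x := by
  rcases subsingleton_or_nontrivial W with hW | hW
  · exact ⟨1, one_pos, fun x => by simp [Subsingleton.elim x 0]⟩
  have hcont : Continuous fun x => B x x := by
    obtain ⟨B', hB⟩ : ∃ B' : W →L[ℝ] W →L[ℝ] ℝ, ∀ x y, B x y = B' x y :=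
      ⟨LinearMap.toContinuousBilinearMap B, fun _ _ => rfl⟩
    simp only [hB]
    fun_prop
  obtain ⟨z, hz, hmin⟩ := (isCompact_sphere (0 : W) 1).exists_isMinOn
    ((NormedSpace.sphere_nonempty).2 zero_le_one) hcont.continuousOn
  have hz0 : z ≠ 0 := by
    rintro rfl
    simp at hz
  refine ⟨B z z, hp z hz0, fun x => ?_⟩
  rcases eq_or_ne x 0 with rfl | hx
  · simp
  have hn : 0 < ‖x‖ := norm_pos_iff.2 hx
  have h := hmin (show ‖x‖⁻¹ • x ∈ Metric.sphere (0 : W) 1 by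
    simp [norm_smul, hn.ne'])
  simp only [Set.mem_ofPred_eq, map_smul, LinearMap.smul_apply, smul_eq_mul] at h
  calc B z z * ‖x‖ ^ 2 ≤ (‖x‖⁻¹ * (‖x‖⁻¹ * B x x)) * ‖x‖ ^ 2 := by gcongr
    _ = B x x := by field_simp

/-- Being nonzero is not a closed condition, but a nonzero idempotent satisfies `‖c‖ = ‖c ∘ c‖ ≤ M
‖c‖ ^ 2`, hence `‖c‖ ≥ 1 / M`. Boundedness follows from `B(c, c) = B(e, c) ≤ B(e, e)`. -/
theorem isCompact_isFrame : IsCompact {c : Fin J.rank → W | J.IsFrame c} := by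
  obtain ⟨B, hs, hp, ha⟩ := J.exists_inner
  have hp' : ∀ x, 0 ≤ B x x := fun x => by
    rcases eq_or_ne x 0 with rfl | h
    · simp
    · exact (hp x h).le
  obtain ⟨a, ha0, hle⟩ := exists_norm_le_of_form hp
  obtain ⟨M, hM0, hM⟩ : ∃ M : ℝ, 0 < M ∧ ∀ x y, ‖J.mul x y‖ ≤ M * ‖x‖ * ‖y‖ :=
    ⟨‖J.mulL‖ + 1, by positivity, fun x y => (J.mulL.le_opNorm₂ x y).trans (by gcongr; simp)⟩
  have hlow : ∀ x, J.mul x x = x → (x ≠ 0 ↔ M⁻¹ ≤ ‖x‖) := by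
    intro x hx
    constructor
    · intro hx0
      have hn : 0 < ‖x‖ := norm_pos_iff.2 hx0
      have h := hM x x
      rw [hx] at h
      rw [inv_le_iff_one_le_mul₀ hM0]
      by_contra! hlt
      nlinarith
    · rintro h rfl
      have := inv_pos.2 hM0
      simp at h
      linarith
  have hup : ∀ c : Fin J.rank → W, J.IsFrame c → ∀ i, ‖c i‖ ≤ Real.sqrt (B J.one J.one / a) := by
    intro c hc i
    apply Real.le_sqrt_of_sq_le
    rw [le_div_iff₀ ha0, _root_.mul_comm]
    refine (hle _).trans ?_
    have h1 : B J.one (c i) = B (c i) (c i) := by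
      nth_rewrite 1 [← (hc.mul_eq i i).trans (if_pos rfl)]
      rw [ha, J.one_mul]
    have h2 := hp' (J.one - c i)
    simp only [map_sub, LinearMap.sub_apply, hs (c i) J.one, h1] at h2
    linarith
  have heq : {c : Fin J.rank → W | J.IsFrame c} = {c | (∀ i, M⁻¹ ≤ ‖c i‖) ∧
      (∀ i j, J.mul (c i) (c j) = if i = j then c i else 0) ∧ ∑ i, c i = J.one} := by
    ext c
    constructor
    · intro h
      exact ⟨fun i => (hlow _ ((h.mul_eq i i).trans (if_pos rfl))).1 (h.ne_zero i), h.mul_eq,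
        h.sum_eq⟩
    · rintro ⟨h1, h2, h3⟩
      exact ⟨fun i => (hlow _ ((h2 i i).trans (if_pos rfl))).2 (h1 i), h2, h3⟩
  refine Metric.isCompact_of_isClosed_isBounded ?_ ?_
  · rw [heq]
    have h1 : IsClosed {c : Fin J.rank → W | ∀ i, M⁻¹ ≤ ‖c i‖} := by
      simp only [Set.ofPred_forall]
      exact isClosed_iInter fun i => isClosed_le (by fun_prop) (by fun_prop)
    have h2 : IsClosed {c : Fin J.rank → W |
        ∀ i j, J.mul (c i) (c j) = if i = j then c i else 0} := by
      simp only [Set.ofPred_forall]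
      refine isClosed_iInter fun i => isClosed_iInter fun j => isClosed_eq ?_ ?_
      · simp only [← mulL_apply]
        fun_prop
      · split_ifs <;> fun_prop
    exact h1.inter (h2.inter (isClosed_eq (by fun_prop) continuous_const))
  · rw [isBounded_iff_forall_norm_le]
    exact ⟨_, fun c hc => (pi_norm_le_iff_of_nonneg (Real.sqrt_nonneg _)).2 (hup c hc)⟩

/-- The elements with a spectral decomposition whose eigenvalues lie in a given closed set form a
closed set. -/
theorem isClosed_spectrum_mem {A : Set (Fin J.rank → ℝ)} (hA : IsClosed A) :
    IsClosed {x : W | ∃ (c : Fin J.rank → W) (a : Fin J.rank → ℝ),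
      J.IsFrame c ∧ a ∈ A ∧ x = ∑ i, a i • c i} := by
  obtain ⟨B, hs, hp, ha⟩ := J.exists_inner
  let Φ := {c : Fin J.rank → W // J.IsFrame c}
  have : CompactSpace Φ := isCompact_iff_compactSpace.1 J.isCompact_isFrame
  -- Frame members are `B`-orthogonal, so the eigenvalues depend continuously on the frame and the
  -- element. The set is thus the projection of a closed set along the compact space of frames,
  -- although `A` need not be compact.
  let ev : Φ × W → Fin J.rank → ℝ := fun q i => B q.2 (q.1.1 i) / B (q.1.1 i) (q.1.1 i)
  obtain ⟨B', hB⟩ : ∃ B' : W →L[ℝ] W →L[ℝ] ℝ, ∀ x y, B x y = B' x y :=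
    ⟨LinearMap.toContinuousBilinearMap B, fun _ _ => rfl⟩
  have hcoord : ∀ i, Continuous fun q : Φ × W => q.1.1 i := fun i =>
    (continuous_apply i).comp (continuous_subtype_val.comp continuous_fst)
  have hev : Continuous ev := by
    refine continuous_pi fun i => Continuous.div ?_ ?_ fun q => (hp _ (q.1.2.ne_zero i)).ne'
    · simp only [hB]
      exact (B'.continuous.comp continuous_snd).clm_apply (hcoord i)
    · simp only [hB]
      exact (B'.continuous.comp (hcoord i)).clm_apply (hcoord i)
  have hval : ∀ (c : Φ) (a : Fin J.rank → ℝ), ev (c, ∑ i, a i • c.1 i) = a := by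
    intro c a
    funext j
    have h : ∀ i, B (c.1 i) (c.1 j) = if i = j then B (c.1 i) (c.1 i) else 0 := by
      intro i
      have h1 : B (c.1 i) (c.1 j) = B J.one (J.mul (c.1 i) (c.1 j)) := by
        rw [ha, J.one_mul]
      rw [h1, c.2.mul_eq]
      split_ifs with hij
      · rw [← (c.2.mul_eq i i).trans (if_pos rfl), ha, J.one_mul,
          (c.2.mul_eq i i).trans (if_pos rfl)]
      · simp
    simp only [ev, map_sum, map_smul, LinearMap.sum_apply, LinearMap.smul_apply, smul_eq_mul]
    rw [Finset.sum_eq_single j, mul_div_cancel_right₀ _ (hp _ (c.2.ne_zero j)).ne']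
    · intro i _ hij
      rw [h i, if_neg hij, mul_zero]
    · simp
  have hZ : IsClosed {q : Φ × W | ev q ∈ A ∧ q.2 = ∑ i, ev q i • q.1.1 i} :=
    by
    refine (hA.preimage hev).inter (isClosed_eq continuous_snd ?_)
    refine continuous_finsetSum _ fun i _ => Continuous.smul ?_ ?_
    · exact (continuous_apply i).comp hev
    · exact hcoord i
  convert isClosedMap_snd_of_compactSpace _ hZ using 1
  ext x
  constructor
  · rintro ⟨c, a, hc, haA, rfl⟩
    have h := hval ⟨c, hc⟩ a
    refine ⟨(⟨c, hc⟩, ∑ i, a i • c i), ⟨?_, ?_⟩, rfl⟩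
    · rw [h]; exact haA
    · rw [h]
  · rintro ⟨⟨c, x'⟩, ⟨h1, h2⟩, rfl⟩
    exact ⟨c.1, _, c.2, h1, h2⟩

/-- Every element is a combination of the members of a Jordan frame. -/
theorem exists_isFrame [Nontrivial W] (x : W) :
    ∃ (c : Fin J.rank → W) (a : Fin J.rank → ℝ), J.IsFrame c ∧ x = ∑ i, a i • c i := by
  have hcl := J.isClosed_spectrum_mem (A := Set.univ) isClosed_univ
  have hd := J.dense_linearIndependent_pow.closure_eq
  have := hcl.closure_subset_iff (s := {x : W | LinearIndependent ℝ
      fun j : Fin J.rank => J.pow x j}) |>.2 (fun y hy => by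
    obtain ⟨c, a, hc, h⟩ := J.exists_isFrame_of_linearIndependent hy
    exact ⟨c, a, hc, Set.mem_univ _, h⟩)
  obtain ⟨c, a, hc, -, h⟩ := this (hd ▸ Set.mem_univ x)
  exact ⟨c, a, hc, h⟩

/-! ### Characteristic polynomial, determinant and trace in a frame. -/

variable {J} {c : Fin J.rank → W}

/-- The case of distinct eigenvalues extends by continuity of the coefficients. -/
theorem IsFrame.charPoly (hc : J.IsFrame c) (a : Fin J.rank → ℝ) :
    J.charPoly (∑ i, a i • c i) = ∏ i, (X - C (a i)) := by
  apply Polynomial.funext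
  intro μ
  have hmon := J.charPoly_spec
  have h1 : ∀ a : Fin J.rank → ℝ, (J.charPoly (∑ i, a i • c i)).eval μ
      = ∑ k ∈ Finset.range (J.rank + 1), (J.charPoly (∑ i, a i • c i)).coeff k * μ ^ k := by
    intro a
    rw [eval_eq_sum_range, hmon.natDegree_eq]
  refine eq_of_eq_on_injective (f := fun a => (J.charPoly (∑ i, a i • c i)).eval μ)
    (g := fun a => (∏ i, (X - C (a i))).eval μ) ?_ ?_ (fun a ha => ?_) a
  · simp only [h1]
    refine continuous_finsetSum _ fun k _ => Continuous.mul ?_ continuous_const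
    exact (J.continuous_charPoly_coeff k).comp (by fun_prop)
  · simp only [eval_prod, eval_sub, eval_X, eval_C]
    fun_prop
  · simp only [hc.charPoly_of_injective ha]

theorem IsFrame.det_eq (hc : J.IsFrame c) (a : Fin J.rank → ℝ) :
    J.det (∑ i, a i • c i) = ∏ i, a i := by
  rw [det, hc.charPoly, coeff_zero_eq_eval_zero, eval_prod]
  simp [Finset.prod_neg, ← mul_assoc, ← mul_pow]

variable (J) in
/-- The trace `a₁(x)`. -/
noncomputable def trace (x : W) : ℝ := -(J.charPoly x).coeff (J.rank - 1)

theorem IsFrame.trace_eq [Nontrivial W] (hc : J.IsFrame c) (a : Fin J.rank → ℝ) :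
    J.trace (∑ i, a i • c i) = ∑ i, a i := by
  have h : 0 < Finset.card (Finset.univ : Finset (Fin J.rank)) := by
    simpa using J.exists_linearIndependent_pow.1
  have := prod_X_sub_C_coeff_card_pred Finset.univ a h
  rw [trace, hc.charPoly]
  simp at this
  rw [this, neg_neg]

end EuclideanJordanProduct

/-! ### Derivatives of the determinant and the trace. -/

namespace EuclideanJordanProduct

variable {W : Type*} [NormedAddCommGroup W] [NormedSpace ℝ W] [FiniteDimensional ℝ W]
  {J : EuclideanJordanProduct W} {c : Fin J.rank → W}

variable (J) in
/-- The derivative of a power, paired with a common eigenvector of the powers. -/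
theorem exists_hasDerivAt_pow {B : W →ₗ[ℝ] W →ₗ[ℝ] ℝ}
    (ha : ∀ x y z, B x (J.mul y z) = B (J.mul x y) z) (x v : W) (n : ℕ) :
    ∃ D : W, HasDerivAt (fun t : ℝ => J.pow (x + t • v) n) D 0 ∧
      ∀ (z : W) (μ : ℝ), (∀ k, J.mul (J.pow x k) z = μ ^ k • z) →
        B D z = n * μ ^ (n - 1) * B v z := by
  induction n with
  | zero => exact ⟨0, hasDerivAt_const _ _, fun z μ _ => by simp⟩
  | succ n ih =>
    obtain ⟨D, hD, hB⟩ := ih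
    have hx : HasDerivAt (fun t : ℝ => x + t • v) v 0 := by
      simpa using ((hasDerivAt_id (0 : ℝ)).smul_const v).const_add x
    refine ⟨J.mul v (J.pow x n) + J.mul x D, ?_, fun z μ hz => ?_⟩
    · have h := (J.mulL.hasFDerivAt_of_bilinear hx.hasFDerivAt hD.hasFDerivAt).hasDerivAt
      simpa [mulL_apply, add_comm, pow] using h
    · have h1 := hz 1
      have h2 : J.pow x 1 = x := by simp [pow, J.mul_one]
      rw [h2, pow_one] at h1
      -- Associativity of `B` moves `x` and its powers onto `z`, where they act as scalars; so it
      -- does not matter that `L(x)` and `L(v)` need not commute.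
      rw [map_add, LinearMap.add_apply, ← ha, hz, J.mul_comm x D, ← ha, h1, map_smul, map_smul,
        hB z μ hz]
      rcases n with _ | n
      · simp
      · simp only [smul_eq_mul, Nat.add_sub_cancel]
        push_cast
        ring

variable (J) in
theorem contDiff_charPoly_coeff (k : ℕ) : ContDiff ℝ 1 fun y => (J.charPoly y).coeff k :=
  contDiff_iff_contDiffAt.2 fun x => (J.analyticAt_charPoly_coeff k x).contDiffAt

/-- The derivative of the characteristic polynomial in direction `v` at an element with distinct
eigenvalues. -/
theorem IsFrame.sum_fderiv_charPoly_coeff [Nontrivial W] (hc : J.IsFrame c)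
    {B : W →ₗ[ℝ] W →ₗ[ℝ] ℝ} (hp : ∀ x, x ≠ 0 → 0 < B x x)
    (ha : ∀ x y z, B x (J.mul y z) = B (J.mul x y) z)
    {a : Fin J.rank → ℝ} (hinj : Function.Injective a) (v : W) :
    ∑ k ∈ Finset.range J.rank,
        C (fderiv ℝ (fun y => (J.charPoly y).coeff k) (∑ i, a i • c i) v) * X ^ k
      = -∑ j, C (B v (c j) / B (c j) (c j)) * ∏ i ∈ Finset.univ.erase j, (X - C (a i)) := by
  set x := ∑ i, a i • c i with hx
  set d : ℕ → ℝ := fun k => fderiv ℝ (fun y => (J.charPoly y).coeff k) x v with hd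
  have hder : ∀ k, HasDerivAt (fun t : ℝ => (J.charPoly (x + t • v)).coeff k) (d k) 0 := by
    intro k
    have hx : HasDerivAt (fun t : ℝ => x + t • v) v 0 := by
      simpa using ((hasDerivAt_id (0 : ℝ)).smul_const v).const_add x
    have h := ((J.contDiff_charPoly_coeff k).differentiable _root_.one_ne_zero
      (x + (0 : ℝ) • v)).hasFDerivAt
    have := h.comp_hasDerivAt (0 : ℝ) hx
    rw [zero_smul, add_zero] at this
    exact this
  -- The leading coefficient is constantly `1`, so the derivative has degree below `rank`.
  have hdr : d J.rank = 0 := by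
    have h : (fun y => (J.charPoly y).coeff J.rank) = fun _ => 1 := by
      funext y
      rw [← J.charPoly_spec.natDegree_eq y]
      exact (J.charPoly_spec.monic y).coeff_natDegree
    simp [hd, h]
  choose D hD hBD using J.exists_hasDerivAt_pow ha x v
  have hsum : ∑ k ∈ Finset.range (J.rank + 1),
      (d k • J.pow x k + (J.charPoly x).coeff k • D k) = 0 := by
    have h1 : HasDerivAt (fun t : ℝ => ∑ k ∈ Finset.range (J.rank + 1),
        (J.charPoly (x + t • v)).coeff k • J.pow (x + t • v) k) _ 0 :=
      HasDerivAt.fun_sum fun k _ => (hder k).smul (hD k)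
    have h2 : (fun t : ℝ => ∑ k ∈ Finset.range (J.rank + 1),
        (J.charPoly (x + t • v)).coeff k • J.pow (x + t • v) k) = fun _ => 0 :=
      funext fun t => J.charPoly_spec.annihilates _
    rw [h2] at h1
    have h3 := h1.unique (hasDerivAt_const _ _)
    simp only [zero_smul, add_zero] at h3
    rw [← h3]
    exact Finset.sum_congr rfl fun k _ => add_comm _ _
  have hpow : ∀ j k, J.mul (J.pow x k) (c j) = a j ^ k • c j := by
    intro j k
    rw [hx, hc.pow_sum, hc.sum_mul (fun i => a i ^ k)]
  -- The derivative of `χ_x(x) = 0` in direction `v`, paired with `c j`.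
  have hpair : ∀ j, (∑ k ∈ Finset.range (J.rank + 1), d k * a j ^ k) * B (c j) (c j)
      + (derivative (J.charPoly x)).eval (a j) * B v (c j) = 0 := by
    intro j
    have h := congrArg (fun w => B w (c j)) hsum
    have hBp : ∀ k, B (J.pow x k) (c j) = a j ^ k * B (c j) (c j) := by
      intro k
      conv_lhs => rw [← (hc.mul_eq j j).trans (if_pos rfl)]
      rw [ha, hpow, map_smul, LinearMap.smul_apply, smul_eq_mul]
    simp only [map_sum, LinearMap.sum_apply, map_add, LinearMap.add_apply, map_smul,
      LinearMap.smul_apply, smul_eq_mul, map_zero, LinearMap.zero_apply, hBp,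
      hBD _ (c j) (a j) (hpow j)] at h
    rw [derivative_eval, sum_over_range _ (by simp), J.charPoly_spec.natDegree_eq,
      Finset.sum_mul, Finset.sum_mul, ← Finset.sum_add_distrib, ← h]
    exact Finset.sum_congr rfl fun k _ => by ring
  have hder2 : ∀ j, (derivative (J.charPoly x)).eval (a j)
      = ∏ i ∈ Finset.univ.erase j, (a j - a i) := by
    intro j
    rw [hx, hc.charPoly, ← Finset.mul_prod_erase _ _ (Finset.mem_univ j), derivative_mul]
    simp [eval_prod]
  -- Both sides have degree below `rank` and are compared at the `rank` distinct eigenvalues.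
  refine eq_of_degrees_lt_of_eval_index_eq (s := Finset.univ) (v := a) hinj.injOn ?_ ?_ ?_
  · rw [Finset.card_univ, Fintype.card_fin]
    refine mem_degreeLT.1 (Submodule.sum_mem _ fun k hk => mem_degreeLT.2 ?_)
    exact (degree_C_mul_X_pow_le _ _).trans_lt (by exact_mod_cast Finset.mem_range.1 hk)
  · rw [Finset.card_univ, Fintype.card_fin, degree_neg]
    refine mem_degreeLT.1 (Submodule.sum_mem _ fun j _ => mem_degreeLT.2 ?_)
    rw [← smul_eq_C_mul]
    refine (degree_smul_le _ _).trans_lt ?_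
    rw [degree_eq_natDegree (monic_prod_X_sub_C _ _).ne_zero,
      natDegree_prod_of_monic _ _ fun i _ => monic_X_sub_C _]
    simpa using J.exists_linearIndependent_pow.1
  · intro j _
    have h0 := (hp _ (hc.ne_zero j)).ne'
    have hev : ∀ i, i ≠ j →
        eval (a j) (∏ l ∈ Finset.univ.erase i, (X - C (a l))) = 0 := by
      intro i hij
      rw [eval_prod]
      exact Finset.prod_eq_zero (i := j) (by simp [hij.symm]) (by simp)
    rw [eval_neg, eval_finsetSum, eval_finsetSum, Finset.sum_eq_single j]
    · have h := hpair j
      rw [Finset.sum_range_succ, hdr, zero_mul, add_zero, hder2] at h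
      simp only [eval_mul, eval_C, eval_pow, eval_X, eval_prod, eval_sub]
      field_simp
      linarith
    · intro i _ hij
      rw [eval_mul, hev i hij, mul_zero]
    · simp

theorem contDiff_det : ContDiff ℝ 1 J.det :=
  contDiff_const.mul (J.contDiff_charPoly_coeff 0)

theorem contDiff_trace : ContDiff ℝ 1 J.trace :=
  (J.contDiff_charPoly_coeff _).neg

theorem IsFrame.fderiv_trace_of_injective [Nontrivial W] (hc : J.IsFrame c)
    {B : W →ₗ[ℝ] W →ₗ[ℝ] ℝ} (hp : ∀ x, x ≠ 0 → 0 < B x x)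
    (ha : ∀ x y z, B x (J.mul y z) = B (J.mul x y) z)
    {a : Fin J.rank → ℝ} (hinj : Function.Injective a) (v : W) :
    fderiv ℝ J.trace (∑ i, a i • c i) v = ∑ j, B v (c j) / B (c j) (c j) := by
  have hr := J.exists_linearIndependent_pow.1
  have h := congrArg (fun p => coeff p (J.rank - 1)) (hc.sum_fderiv_charPoly_coeff hp ha hinj v)
  have hco : ∀ j : Fin J.rank,
      (∏ i ∈ Finset.univ.erase j, (X - C (a i))).coeff (J.rank - 1) = 1 := by
    intro j
    have hm := (monic_prod_X_sub_C a (Finset.univ.erase j)).coeff_natDegree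
    rw [natDegree_prod_of_monic _ _ fun i _ => monic_X_sub_C _] at hm
    simpa using hm
  simp only [finsetSum_coeff, coeff_C_mul, coeff_X_pow, coeff_neg, hco, mul_ite, mul_zero,
    Finset.sum_ite_eq, Finset.mem_range, _root_.mul_one, Nat.sub_lt hr one_pos, if_true] at h
  have h2 : fderiv ℝ J.trace = fun x => -fderiv ℝ (fun y => (J.charPoly y).coeff (J.rank - 1)) x :=
    funext fun x => fderiv_fun_neg
  rw [h2, neg_apply, h, neg_neg]

/-- The constant coefficient of the derivative formula; coinciding eigenvalues are reached by
continuity, as `det` is continuously differentiable. -/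
theorem IsFrame.fderiv_det [Nontrivial W] (hc : J.IsFrame c)
    {B : W →ₗ[ℝ] W →ₗ[ℝ] ℝ} (hp : ∀ x, x ≠ 0 → 0 < B x x)
    (ha : ∀ x y z, B x (J.mul y z) = B (J.mul x y) z) (a : Fin J.rank → ℝ) (v : W) :
    fderiv ℝ J.det (∑ i, a i • c i) v
      = ∑ j, B v (c j) / B (c j) (c j) * ∏ i ∈ Finset.univ.erase j, a i := by
  have hr := J.exists_linearIndependent_pow.1
  refine eq_of_eq_on_injective (f := fun a => fderiv ℝ J.det (∑ i, a i • c i) v)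
    (g := fun a => ∑ j, B v (c j) / B (c j) (c j) * ∏ i ∈ Finset.univ.erase j, a i)
    ?_ (by fun_prop) (fun a hinj => ?_) a
  · have h1 := J.contDiff_det.continuous_fderiv _root_.one_ne_zero
    exact (h1.comp (f := fun a : Fin J.rank → ℝ => ∑ i, a i • c i) (by fun_prop)).clm_apply
      continuous_const
  · have h := congrArg (fun p => eval 0 p) (hc.sum_fderiv_charPoly_coeff hp ha hinj v)
    have hpr : ∀ j : Fin J.rank,
        ∏ i ∈ Finset.univ.erase j, (-a i) = (-1) ^ (J.rank - 1) * ∏ i ∈ Finset.univ.erase j, a i := by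
      intro j
      rw [Finset.prod_neg]
      simp
    simp only [eval_finsetSum, eval_mul, eval_C, eval_pow, eval_X, eval_neg, eval_prod, eval_sub,
      zero_sub, hpr] at h
    rw [Finset.sum_eq_single_of_mem 0 (Finset.mem_range.2 hr)
      (fun k _ hk => by rw [zero_pow hk, mul_zero]), pow_zero, _root_.mul_one] at h
    have h2 : fderiv ℝ J.det (∑ i, a i • c i)
        = (-1 : ℝ) ^ J.rank • fderiv ℝ (fun y => (J.charPoly y).coeff 0) (∑ i, a i • c i) :=
      fderiv_const_mul ((J.contDiff_charPoly_coeff 0).differentiable _root_.one_ne_zero _) _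
    simp only [h2, smul_apply, h, smul_eq_mul]
    rw [mul_neg, Finset.mul_sum, ← Finset.sum_neg_distrib]
    refine Finset.sum_congr rfl fun j _ => ?_
    obtain ⟨m, hm⟩ := Nat.exists_eq_succ_of_ne_zero hr.ne'
    have h3 : (-1 : ℝ) ^ J.rank * (-1) ^ (J.rank - 1) = -1 := by
      rw [← pow_add]
      exact Odd.neg_one_pow ⟨m, by omega⟩
    linear_combination (-(B v (c j) / B (c j) (c j) * ∏ i ∈ Finset.univ.erase j, a i)) * h3

/-- The trace is the sum of the coefficients of the diagonal Peirce components. -/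
theorem IsFrame.trace_eq_sum_form [Nontrivial W] (hc : J.IsFrame c)
    {B : W →ₗ[ℝ] W →ₗ[ℝ] ℝ} (hp : ∀ x, x ≠ 0 → 0 < B x x)
    (ha : ∀ x y z, B x (J.mul y z) = B (J.mul x y) z) (v : W) :
    J.trace v = ∑ j, B v (c j) / B (c j) (c j) := by
  have hhom : ∀ (t : ℝ) (x : W), J.trace (t • x) = t * J.trace x := by
    intro t x
    obtain ⟨c, a, hc, rfl⟩ := J.exists_isFrame x
    simp only [Finset.smul_sum, smul_smul, hc.trace_eq, Finset.mul_sum]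
  have hdiff : Differentiable ℝ J.trace := J.contDiff_trace.differentiable _root_.one_ne_zero
  -- A homogeneous function that is differentiable at `0` equals its derivative there. So the trace
  -- is linear, and its derivative may be computed at any element of the frame with distinct
  -- eigenvalues, here `0, 1, 2, …`.
  have h0 : ∀ v, J.trace v = fderiv ℝ J.trace 0 v := by
    intro v
    have h1 : HasDerivAt (fun t : ℝ => J.trace (t • v)) (fderiv ℝ J.trace 0 v) 0 := by
      have h := (hdiff ((0 : ℝ) • v)).hasFDerivAt.comp_hasDerivAt (0 : ℝ)
        ((hasDerivAt_id (0 : ℝ)).smul_const v)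
      rw [zero_smul, one_smul] at h
      exact h
    simp only [hhom] at h1
    have h2 : HasDerivAt (fun t : ℝ => t * J.trace v) (J.trace v) 0 := by
      simpa using (hasDerivAt_id (0 : ℝ)).mul_const (J.trace v)
    exact h2.unique h1
  have h1 : ∀ x, fderiv ℝ J.trace x = fderiv ℝ J.trace 0 := by
    intro x
    conv_lhs => rw [funext h0]
    exact (fderiv ℝ J.trace 0).fderiv
  have hinj : Function.Injective fun i : Fin J.rank => ((i : ℕ) : ℝ) :=
    fun i j hij => Fin.ext (Nat.cast_injective (R := ℝ) hij)
  rw [h0, ← hc.fderiv_trace_of_injective hp ha hinj v, h1 (∑ i, _)]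

/-- The infinitesimal form of `det_flow`: associativity gives `B(u ∘ x, c_j) = a_j B(u, c_j)`, and
`a_j` completes the product of the other eigenvalues to `det x`. -/
theorem fderiv_det_mul [Nontrivial W] (x u : W) :
    fderiv ℝ J.det x (J.mul u x) = J.trace u * J.det x := by
  obtain ⟨B, hs, hp, ha⟩ := J.exists_inner
  obtain ⟨c, a, hc, rfl⟩ := J.exists_isFrame x
  rw [hc.fderiv_det hp ha, hc.det_eq, hc.trace_eq_sum_form hp ha, Finset.sum_mul]
  refine Finset.sum_congr rfl fun j _ => ?_
  rw [← ha, hc.sum_mul, map_smul, smul_eq_mul, ← Finset.mul_prod_erase _ _ (Finset.mem_univ j)]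
  ring

end EuclideanJordanProduct

/-! ### The flows `exp (t L(u))` and homogeneity of the cone. -/

namespace EuclideanJordanProduct

theorem IsFrame.add_smul_one {W : Type*} [AddCommGroup W] [Module ℝ W]
    {J : EuclideanJordanProduct W} {c : Fin J.rank → W} (hc : J.IsFrame c) (a : Fin J.rank → ℝ)
    (s t : ℝ) : s • J.one + t • ∑ i, a i • c i = ∑ i, (s + t * a i) • c i := by
  simp only [add_smul, Finset.sum_add_distrib, ← Finset.smul_sum, hc.sum_eq, mul_smul]

section Flow

variable {W : Type*} [NormedAddCommGroup W] [NormedSpace ℝ W] [FiniteDimensional ℝ W]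
  (J : EuclideanJordanProduct W)

/-- The one-parameter group `exp (t L(u))` generated by multiplication by `u`. -/
noncomputable def flow (u : W) (t : ℝ) : W →L[ℝ] W := NormedSpace.exp (t • J.mulL u)

theorem flow_zero (u x : W) : J.flow u 0 x = x := by
  simp [flow, NormedSpace.exp_zero]

theorem flow_add (u x : W) (s t : ℝ) : J.flow u (s + t) x = J.flow u s (J.flow u t x) := by
  let : NormedAlgebra ℚ (W →L[ℝ] W) := NormedAlgebra.restrictScalars ℚ ℝ _
  have h : Commute (s • J.mulL u) (t • J.mulL u) :=
    ((Commute.refl (J.mulL u)).smul_left s).smul_right t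
  rw [flow, add_smul, NormedSpace.exp_add_of_commute h]
  rfl

theorem flow_neg_flow (u x : W) (t : ℝ) : J.flow u (-t) (J.flow u t x) = x := by
  rw [← flow_add, neg_add_cancel, flow_zero]

theorem flow_flow_neg (u x : W) (t : ℝ) : J.flow u t (J.flow u (-t) x) = x := by
  rw [← flow_add, add_neg_cancel, flow_zero]

theorem hasDerivAt_flow (u x : W) (t : ℝ) :
    HasDerivAt (fun t => J.flow u t x) (J.mul u (J.flow u t x)) t := by
  have h := (hasDerivAt_exp_smul_const' (J.mulL u) t).clm_apply (hasDerivAt_const t x)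
  simp only [map_zero, add_zero] at h
  exact h

theorem hasDerivAt_flow' (u x : W) (t : ℝ) :
    HasDerivAt (fun t => J.flow u t x) (J.flow u t (J.mul u x)) t := by
  have h := (hasDerivAt_exp_smul_const (J.mulL u) t).clm_apply (hasDerivAt_const t x)
  simp only [map_zero, add_zero] at h
  exact h

theorem flow_eigenvector {u x : W} {a : ℝ} (h : J.mul u x = a • x) (t : ℝ) :
    J.flow u t x = Real.exp (t * a) • x := by
  have hd : ∀ t, HasDerivAt (fun t => Real.exp (-(t * a)) • J.flow u t x) 0 t := by
    intro t
    have h1 : HasDerivAt (fun t : ℝ => Real.exp (-(t * a))) (Real.exp (-(t * a)) * -a) t := by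
      simpa using (((hasDerivAt_id t).mul_const a).neg).exp
    have h2 := h1.smul (J.hasDerivAt_flow' u x t)
    have h3 : Real.exp (-(t * a)) • J.flow u t (J.mul u x)
        + (Real.exp (-(t * a)) * -a) • J.flow u t x = 0 := by
      rw [h, map_smul]
      module
    rw [h3] at h2
    exact h2
  have hconst := is_const_of_deriv_eq_zero (fun t => (hd t).differentiableAt)
    (fun t => (hd t).deriv) t 0
  simp only [zero_mul, neg_zero, Real.exp_zero, one_smul, flow_zero] at hconst
  conv_rhs => rw [← hconst, smul_smul, ← Real.exp_add, add_neg_cancel, Real.exp_zero, one_smul]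

variable [Nontrivial W]

theorem det_flow (u x : W) (t : ℝ) :
    J.det (J.flow u t x) = Real.exp (t * J.trace u) * J.det x := by
  have hd : ∀ t, HasDerivAt (fun t => Real.exp (-(t * J.trace u)) * J.det (J.flow u t x)) 0 t := by
    intro t
    have h1 : HasDerivAt (fun t : ℝ => Real.exp (-(t * J.trace u)))
        (Real.exp (-(t * J.trace u)) * -J.trace u) t := by
      simpa using (((hasDerivAt_id t).mul_const (J.trace u)).neg).exp
    have h2 : HasDerivAt (fun t => J.det (J.flow u t x))
        (fderiv ℝ J.det (J.flow u t x) (J.mul u (J.flow u t x))) t :=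
      (J.contDiff_det.differentiable _root_.one_ne_zero _).hasFDerivAt.comp_hasDerivAt t
        (J.hasDerivAt_flow u x t)
    have h3 := h1.mul h2
    have h4 : Real.exp (-(t * J.trace u)) * -J.trace u * J.det (J.flow u t x)
        + Real.exp (-(t * J.trace u)) *
          fderiv ℝ J.det (J.flow u t x) (J.mul u (J.flow u t x)) = 0 := by
      rw [fderiv_det_mul]
      ring
    rw [h4] at h3
    exact h3
  have hconst := is_const_of_deriv_eq_zero (fun t => (hd t).differentiableAt)
    (fun t => (hd t).deriv) t 0
  simp only [zero_mul, neg_zero, Real.exp_zero, _root_.one_mul, flow_zero] at hconst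
  rw [← hconst, ← mul_assoc, ← Real.exp_add, add_neg_cancel, Real.exp_zero, _root_.one_mul]

variable {J}

theorem mem_cone_iff {x : W} : x ∈ J.cone ↔ ∃ (c : Fin J.rank → W) (a : Fin J.rank → ℝ),
    J.IsFrame c ∧ a ∈ {a | ∀ i, 0 ≤ a i} ∧ x = ∑ i, a i • c i := by
  constructor
  · rintro ⟨u, rfl⟩
    obtain ⟨c, a, hc, rfl⟩ := J.exists_isFrame u
    exact ⟨c, fun i => a i * a i, hc, fun i => mul_self_nonneg _, hc.sum_mul_sum a a⟩
  · rintro ⟨c, a, hc, ha, rfl⟩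
    refine ⟨∑ i, √(a i) • c i, ?_⟩
    simp only [hc.sum_mul_sum, Real.mul_self_sqrt (ha _)]

theorem isClosed_cone : IsClosed J.cone := by
  have h : IsClosed {a : Fin J.rank → ℝ | ∀ i, 0 ≤ a i} := by
    simp only [Set.ofPred_forall]
    exact isClosed_iInter fun i => isClosed_le continuous_const (continuous_apply i)
  convert J.isClosed_spectrum_mem h using 1
  ext x
  exact mem_cone_iff

theorem exists_pos_of_mem_cone {x : W} (hx : x ∈ J.cone) (hd : 0 < J.det x) :
    ∃ (c : Fin J.rank → W) (a : Fin J.rank → ℝ),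
      J.IsFrame c ∧ (∀ i, 0 < a i) ∧ x = ∑ i, a i • c i := by
  obtain ⟨c, a, hc, ha, rfl⟩ := mem_cone_iff.1 hx
  rw [hc.det_eq] at hd
  exact ⟨c, a, hc, fun i => (ha i).lt_of_ne' fun h => hd.ne'
    (Finset.prod_eq_zero (Finset.mem_univ i) h), rfl⟩

theorem pos_of_add_mem_cone {x : W} (hx : x ∈ J.cone) {ε : ℝ} (hε : 0 < ε) :
    x + ε • J.one ∈ J.cone ∧ 0 < J.det (x + ε • J.one) := by
  obtain ⟨c, a, hc, ha, rfl⟩ := mem_cone_iff.1 hx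
  have h : ∑ i, a i • c i + ε • J.one = ∑ i, (ε + 1 * a i) • c i := by
    rw [← hc.add_smul_one, one_smul, add_comm]
  have hp : ∀ i, 0 < ε + 1 * a i := fun i => by
    have := ha i
    linarith
  rw [h, hc.det_eq]
  exact ⟨mem_cone_iff.2 ⟨c, _, hc, fun i => (hp i).le, rfl⟩,
    Finset.prod_pos fun i _ => hp i⟩

/-- The cone of squares is invariant under the flows. -/
theorem flow_mem_cone_of_det_pos (u : W) {x : W} (hx : x ∈ J.cone) (hd : 0 < J.det x) (t : ℝ) :
    J.flow u t x ∈ J.cone := by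
  have hcont : Continuous fun t => J.flow u t x :=
    continuous_iff_continuousAt.2 fun t => (J.hasDerivAt_flow u x t).continuousAt
  have hdet : ∀ t, 0 < J.det (J.flow u t x) := fun t => by
    rw [det_flow]
    exact mul_pos (Real.exp_pos _) hd
  have hN : IsClosed {a : Fin J.rank → ℝ | ∃ i, a i ≤ 0} := by
    simp only [Set.ofPred_exists]
    exact isClosed_iUnion_of_finite fun i => isClosed_le (continuous_apply i) continuous_const
  have hcl := (J.isClosed_spectrum_mem hN).preimage hcont
  -- Connectedness of the line: the determinant stays positive on the orbit, so leaving the cone is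
  -- the same as having some eigenvalue `≤ 0`, and this is a closed condition.
  have hclopen : IsClopen ((fun t => J.flow u t x) ⁻¹' J.cone) := by
    refine ⟨isClosed_cone.preimage hcont, ?_⟩
    rw [← isClosed_compl_iff]
    convert hcl using 1
    ext t
    simp only [Set.mem_compl_iff, Set.mem_preimage]
    constructor
    · intro h
      obtain ⟨c, a, hc, hx⟩ := J.exists_isFrame (J.flow u t x)
      refine ⟨c, a, hc, ?_, hx⟩
      by_contra! hn
      simp only [Set.mem_ofPred_eq, not_exists, not_le] at hn
      exact h (mem_cone_iff.2 ⟨c, a, hc, fun i => (hn i).le, hx⟩)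
    · rintro ⟨c, a, hc, ⟨i, hi⟩, h1⟩ h2
      obtain ⟨c', a', hc', ha', h3⟩ := exists_pos_of_mem_cone h2 (hdet t)
      -- The two frames may differ, but the eigenvalues in either are the roots of the same
      -- characteristic polynomial.
      have h4 : (J.charPoly (J.flow u t x)).eval (a i) = 0 := by
        rw [h1, hc.charPoly, eval_prod]
        exact Finset.prod_eq_zero (Finset.mem_univ i) (by simp)
      rw [h3, hc'.charPoly, eval_prod, Finset.prod_eq_zero_iff] at h4
      obtain ⟨j, -, hj⟩ := h4
      have := ha' j
      simp only [eval_sub, eval_X, eval_C] at hj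
      linarith
  have huniv := hclopen.eq_univ ⟨0, by simpa [flow_zero] using hx⟩
  exact Set.eq_univ_iff_forall.1 huniv t

theorem flow_mem_cone (u : W) {x : W} (hx : x ∈ J.cone) (t : ℝ) : J.flow u t x ∈ J.cone := by
  have hl : Filter.Tendsto (fun ε : ℝ => J.flow u t (x + ε • J.one)) (nhdsWithin 0 (Set.Ioi 0))
      (nhds (J.flow u t x)) := by
    have hc : Continuous fun ε : ℝ => J.flow u t (x + ε • J.one) := by fun_prop
    have := hc.tendsto 0
    simp only [zero_smul, add_zero] at this
    exact this.mono_left nhdsWithin_le_nhds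
  refine isClosed_cone.mem_of_tendsto hl ?_
  filter_upwards [self_mem_nhdsWithin] with ε hε
  obtain ⟨h1, h2⟩ := pos_of_add_mem_cone hx hε
  exact flow_mem_cone_of_det_pos u h1 h2 t

/-- The cone of squares is homogeneous, by automorphisms that scale the determinant. -/
theorem exists_automorphism {y : W} (hy : y ∈ J.cone) (hd : 0 < J.det y) :
    ∃ g h : W →L[ℝ] W, (∀ x, g (h x) = x) ∧ (∀ x, h (g x) = x) ∧ g J.one = y ∧
      (∀ x, J.det (g x) = J.det y * J.det x) ∧ (∀ x ∈ J.cone, g x ∈ J.cone) ∧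
      ∀ x ∈ J.cone, h x ∈ J.cone := by
  obtain ⟨c, a, hc, ha, rfl⟩ := exists_pos_of_mem_cone hy hd
  -- `u` is the logarithm of `y`; each `c i` is an eigenvector of `L(u)`, so `exp L(u)` sends `e = ∑
  -- c i` to `y`.
  let u := ∑ i, Real.log (a i) • c i
  have hone : J.flow u 1 J.one = ∑ i, a i • c i := by
    rw [← hc.sum_eq, map_sum]
    refine Finset.sum_congr rfl fun i _ => ?_
    rw [J.flow_eigenvector (hc.sum_mul (fun i => Real.log (a i)) i), _root_.one_mul,
      Real.exp_log (ha i)]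
  refine ⟨J.flow u 1, J.flow u (-1), fun x => J.flow_flow_neg u x 1,
    fun x => J.flow_neg_flow u x 1, hone, fun x => ?_, fun x hx => flow_mem_cone u hx 1,
    fun x hx => flow_mem_cone u hx (-1)⟩
  have h1 : J.det J.one = 1 := by
    have := hc.det_eq fun _ => 1
    simpa [hc.sum_eq] using this
  rw [← hone, det_flow, det_flow, h1, _root_.mul_one]

end Flow
end EuclideanJordanProduct

/-! ### Log-convexity of the derivative of `log det`. -/

/-- Hölder's inequality for weighted geometric means of two sequences. -/
theorem sum_rpow_mul_rpow_le {ι : Type*} (S : Finset ι) {A B : ι → ℝ} (hA : ∀ i ∈ S, 0 ≤ A i)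
    (hB : ∀ i ∈ S, 0 ≤ B i) {s t : ℝ} (hs : 0 < s) (ht : 0 < t) (hst : s + t = 1) :
    ∑ i ∈ S, A i ^ s * B i ^ t ≤ (∑ i ∈ S, A i) ^ s * (∑ i ∈ S, B i) ^ t := by
  have hpq : (1 / s).HolderConjugate (1 / t) := by
    rw [Real.holderConjugate_iff]
    refine ⟨(one_lt_div hs).2 (by linarith), by simpa using hst⟩
  have h := Real.inner_le_Lp_mul_Lq_of_nonneg S hpq
    (fun i hi => Real.rpow_nonneg (hA i hi) s) (fun i hi => Real.rpow_nonneg (hB i hi) t)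
  simp only [one_div_one_div] at h
  have h1 : ∀ i ∈ S, (A i ^ s) ^ (1 / s) = A i := fun i hi => by
    rw [← Real.rpow_mul (hA i hi), mul_one_div_cancel hs.ne', Real.rpow_one]
  have h2 : ∀ i ∈ S, (B i ^ t) ^ (1 / t) = B i := fun i hi => by
    rw [← Real.rpow_mul (hB i hi), mul_one_div_cancel ht.ne', Real.rpow_one]
  rwa [Finset.sum_congr rfl h1, Finset.sum_congr rfl h2] at h

namespace EuclideanJordanProduct

theorem smul_mem_cone {W : Type*} [AddCommGroup W] [Module ℝ W] {J : EuclideanJordanProduct W}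
    {x : W} (hx : x ∈ J.cone) {t : ℝ} (ht : 0 ≤ t) : t • x ∈ J.cone := by
  obtain ⟨u, rfl⟩ := hx
  refine ⟨√t • u, ?_⟩
  simp only [map_smul, LinearMap.smul_apply, smul_smul, Real.mul_self_sqrt ht]

variable {W : Type*} [NormedAddCommGroup W] [NormedSpace ℝ W] [FiniteDimensional ℝ W]
  {J : EuclideanJordanProduct W}

variable (J) in
/-- The derivative of `log det` at `y` in direction `w`. -/
noncomputable def logDetDeriv (y w : W) : ℝ := fderiv ℝ J.det y w / J.det y

/-- `log det` transforms by an additive constant under an automorphism. -/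
theorem logDetDeriv_automorphism {g : W →L[ℝ] W} {d : ℝ} (hd : d ≠ 0)
    (hg : ∀ x, J.det (g x) = d * J.det x) (x v : W) :
    J.logDetDeriv (g x) (g v) = J.logDetDeriv x v := by
  have hdiff := J.contDiff_det.differentiable _root_.one_ne_zero
  have h1 : HasFDerivAt (fun x => J.det (g x)) ((fderiv ℝ J.det (g x)).comp g) x :=
    (hdiff (g x)).hasFDerivAt.comp x g.hasFDerivAt
  have h2 : HasFDerivAt (fun x => d * J.det x) (d • fderiv ℝ J.det x) x :=
    (hdiff x).hasFDerivAt.const_mul d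
  simp only [hg] at h1
  have h3 := DFunLike.congr_fun (h1.unique h2) v
  simp only [ContinuousLinearMap.comp_apply, smul_apply, smul_eq_mul] at h3
  rw [logDetDeriv, logDetDeriv, hg, h3, mul_div_mul_left _ _ hd]

variable [Nontrivial W]

/-- For `x + ε e` in place of `x`, an automorphism reduces the claim to adding `e` to an element of
the cone, which only shifts eigenvalues; then `ε → 0`. -/
theorem add_mem_cone {x y : W} (hx : x ∈ J.cone) (hy : y ∈ J.cone) : x + y ∈ J.cone := by
  have hl : Filter.Tendsto (fun ε : ℝ => (x + ε • J.one) + y) (nhdsWithin 0 (Set.Ioi 0))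
      (nhds (x + y)) := by
    have hc : Continuous fun ε : ℝ => (x + ε • J.one) + y := by fun_prop
    have := hc.tendsto 0
    simp only [zero_smul, add_zero] at this
    exact this.mono_left nhdsWithin_le_nhds
  refine isClosed_cone.mem_of_tendsto hl ?_
  filter_upwards [self_mem_nhdsWithin] with ε hε
  obtain ⟨h1, h2⟩ := pos_of_add_mem_cone hx hε
  obtain ⟨g, h, hgh, -, hg1, -, hgc, hhc⟩ := exists_automorphism h1 h2
  obtain ⟨h3, -⟩ := pos_of_add_mem_cone (hhc y hy) one_pos
  have h4 : (x + ε • J.one) + y = g (h y + (1 : ℝ) • J.one) := by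
    rw [one_smul, map_add, hgh, hg1, add_comm]
  rw [h4]
  exact hgc _ h3

theorem convex_cone : Convex ℝ J.cone := fun _ hx _ hy _ _ hs ht _ =>
  add_mem_cone (smul_mem_cone hx hs) (smul_mem_cone hy ht)

/-- For small `ε > 0` the element `y - ε e` is still in the cone, so all eigenvalues of `y` are at
least `ε`. -/
theorem det_pos_of_mem_interior {y : W} (hy : y ∈ interior J.cone) : 0 < J.det y := by
  have hc : Continuous fun ε : ℝ => y - ε • J.one := by fun_prop
  have h0 := hc.tendsto 0
  simp only [zero_smul, sub_zero] at h0
  have h1 := (h0.mono_left (nhdsWithin_le_nhds (s := Set.Ioi 0))).eventually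
    (mem_interior_iff_mem_nhds.1 hy)
  obtain ⟨ε, h2, hε⟩ := (h1.and self_mem_nhdsWithin).exists
  have h3 := (pos_of_add_mem_cone h2 hε).2
  simpa using h3

theorem IsFrame.logDetDeriv_eq {c : Fin J.rank → W} (hc : J.IsFrame c)
    {B : W →ₗ[ℝ] W →ₗ[ℝ] ℝ} (hp : ∀ x, x ≠ 0 → 0 < B x x)
    (ha : ∀ x y z, B x (J.mul y z) = B (J.mul x y) z) {a : Fin J.rank → ℝ} (h0 : ∀ i, 0 < a i)
    (v : W) : J.logDetDeriv (∑ i, a i • c i) v = ∑ j, B v (c j) / B (c j) (c j) / a j := by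
  rw [logDetDeriv, hc.fderiv_det hp ha, hc.det_eq, Finset.sum_div]
  refine Finset.sum_congr rfl fun j _ => ?_
  have h1 : ∏ i ∈ Finset.univ.erase j, a i ≠ 0 := Finset.prod_ne_zero_iff.2 fun i _ => (h0 i).ne'
  rw [← Finset.mul_prod_erase _ _ (Finset.mem_univ j), mul_div_mul_right _ _ h1]

theorem logDetDeriv_one (v : W) : J.logDetDeriv J.one v = J.trace v := by
  obtain ⟨B, -, hp, ha⟩ := J.exists_inner
  obtain ⟨c, a, hc, -⟩ := J.exists_isFrame J.one
  have h := hc.logDetDeriv_eq hp ha (a := fun _ => 1) (fun _ => one_pos) v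
  rw [hc.trace_eq_sum_form hp ha]
  simpa [hc.sum_eq] using h

/-- After transport of `y` to `e` the derivative is the trace of a nonzero element of the cone, a
sum of nonnegative eigenvalues that are not all zero. -/
theorem logDetDeriv_pos {y w : W} (hy : y ∈ J.cone) (hd : 0 < J.det y) (hw : w ∈ J.cone)
    (hw0 : w ≠ 0) : 0 < J.logDetDeriv y w := by
  obtain ⟨g, h, hgh, hhg, hg1, hgd, hgc, hhc⟩ := exists_automorphism hy hd
  rw [← hg1, ← hgh w, logDetDeriv_automorphism hd.ne' hgd, logDetDeriv_one]
  obtain ⟨c, a, hc, ha, hx⟩ := mem_cone_iff.1 (hhc w hw)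
  have hne : h w ≠ 0 := fun h0 => hw0 (by rw [← hgh w, h0, map_zero])
  rw [hx, hc.trace_eq]
  refine lt_of_le_of_ne (Finset.sum_nonneg fun i _ => ha i) fun h0 => hne ?_
  have := (Finset.sum_eq_zero_iff_of_nonneg fun i _ => ha i).1 h0.symm
  rw [hx]
  exact Finset.sum_eq_zero fun i hi => by rw [this i hi, zero_smul]

/-- The derivative of `log det` in a direction of the cone is log-convex. -/
theorem logDetDeriv_le_rpow {y₁ y₂ w : W} (hy₁ : y₁ ∈ J.cone) (hd₁ : 0 < J.det y₁)
    (hy₂ : y₂ ∈ J.cone) (hd₂ : 0 < J.det y₂) (hw : w ∈ J.cone) {s t : ℝ} (hs : 0 < s)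
    (ht : 0 < t) (hst : s + t = 1) :
    J.logDetDeriv (s • y₁ + t • y₂) w ≤ J.logDetDeriv y₁ w ^ s * J.logDetDeriv y₂ w ^ t := by
  obtain ⟨B, -, hp, ha⟩ := J.exists_inner
  obtain ⟨g, h, hgh, hhg, hg1, hgd, hgc, hhc⟩ := exists_automorphism hy₁ hd₁
  have hz : 0 < J.det (h y₂) := by
    have := hgd (h y₂)
    rw [hgh] at this
    rw [this] at hd₂
    exact (mul_pos_iff_of_pos_left hd₁).1 hd₂
  -- `g` sends `e` to `y₁`, so a frame for `h y₂` diagonalizes both pulled-back points, and with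
  -- them the whole segment.
  obtain ⟨c, a, hc, ha0, hx⟩ := exists_pos_of_mem_cone (hhc _ hy₂) hz
  have e1 : s • y₁ + t • y₂ = g (∑ i, (s + t * a i) • c i) := by
    rw [← hc.add_smul_one, ← hx, map_add, map_smul, map_smul, hg1, hgh]
  have e0 : y₁ = g (∑ i, (1 : ℝ) • c i) := by
    simp only [one_smul, hc.sum_eq, hg1]
  have e2 : y₂ = g (∑ i, a i • c i) := by rw [← hx, hgh]
  have hpos : ∀ i, 0 < s + t * a i := fun i => by have := ha0 i; positivity
  let b : Fin J.rank → ℝ := fun j => B (h w) (c j) / B (c j) (c j)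
  have hb : ∀ j, 0 ≤ b j := by
    intro j
    obtain ⟨v, hv⟩ := hhc w hw
    refine div_nonneg ?_ (hp _ (hc.ne_zero j)).le
    rw [← hv]
    exact J.inner_mul_idempotent_nonneg hp ha ((hc.mul_eq j j).trans (if_pos rfl)) v
  have f1 : J.logDetDeriv (s • y₁ + t • y₂) w = ∑ j, b j / (s + t * a j) := by
    rw [e1, ← hgh w, logDetDeriv_automorphism hd₁.ne' hgd, hc.logDetDeriv_eq hp ha hpos]
  have f0 : J.logDetDeriv y₁ w = ∑ j, b j := by
    conv_lhs => rw [e0, ← hgh w, logDetDeriv_automorphism hd₁.ne' hgd,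
      hc.logDetDeriv_eq hp ha fun _ => one_pos]
    simp only [div_one, b]
  have f2 : J.logDetDeriv y₂ w = ∑ j, b j / a j := by
    conv_lhs => rw [e2, ← hgh w, logDetDeriv_automorphism hd₁.ne' hgd,
      hc.logDetDeriv_eq hp ha ha0]
  rw [f1, f0, f2]
  refine le_trans (Finset.sum_le_sum fun j _ => ?_)
    (sum_rpow_mul_rpow_le _ (fun j _ => hb j) (fun j _ => div_nonneg (hb j) (ha0 j).le) hs ht hst)
  -- Since `s + t = 1`, `b ^ s (b / a) ^ t = b / a ^ t`, and it remains to use `a ^ t ≤ s + t a`.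
  rw [Real.div_rpow (hb j) (ha0 j).le, ← mul_div_assoc, ← Real.rpow_add' (hb j) (by simp [hst]),
    hst, Real.rpow_one]
  have hamgm := Real.geom_mean_le_arith_mean2_weighted hs.le ht.le zero_le_one (ha0 j).le hst
  rw [Real.one_rpow, _root_.one_mul, _root_.mul_one] at hamgm
  exact div_le_div_of_nonneg_left (hb j) (Real.rpow_pos_of_pos (ha0 j) t) hamgm

end EuclideanJordanProduct

/-! ### Combination of the algebras. -/

theorem mainTheorem6 {W : Type*} [NormedAddCommGroup W] [InnerProductSpace ℝ W]
    [FiniteDimensional ℝ W] [Nontrivial W] {s : ℕ} (J : Fin s → EuclideanJordanProduct W)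
    (β : Fin s → ℝ)
    (hβ : ∀ i, 0 < β i) (hβ_sum : ∑ i, β i = 1) (K₂ : Set W) (hK₂ : K₂ = ⋂ i, (J i).cone) :
    (∀ y ∈ interior K₂,
      (∀ i, 0 < (J i).det y) ∧
      DifferentiableAt ℝ (logDetCombination J β) y ∧
      ∀ w ∈ K₂, w ≠ 0 → 0 < inner ℝ (gradient (logDetCombination J β) y) w) ∧
    ∀ w ∈ K₂, ConvexOn ℝ (interior K₂) (logGradientPairing (logDetCombination J β) w) := by
  have hsub : ∀ i, K₂ ⊆ (J i).cone := fun i => hK₂ ▸ Set.iInter_subset _ i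
  have hdet : ∀ y ∈ interior K₂, ∀ i, 0 < (J i).det y := fun y hy i =>
    (J i).det_pos_of_mem_interior (interior_mono (hsub i) hy)
  have hmem : ∀ y ∈ interior K₂, ∀ i, y ∈ (J i).cone := fun y hy i =>
    hsub i (interior_subset hy)
  have hconv : Convex ℝ (interior K₂) := by
    rw [hK₂]
    exact (convex_iInter fun i => (J i).convex_cone).interior
  have hγ : ∀ i, 0 < β i * ((J i).rank : ℝ)⁻¹ := fun i =>
    mul_pos (hβ i) (inv_pos.2 (by exact_mod_cast (J i).exists_linearIndependent_pow.1))
  -- The weights sum to `1`, so there is at least one algebra; strict positivity of the sum needs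
  -- this.
  have hne : (Finset.univ : Finset (Fin s)).Nonempty := by
    rw [Finset.nonempty_iff_ne_empty]
    intro h
    rw [h, Finset.sum_empty] at hβ_sum
    exact zero_ne_one hβ_sum
  have hfd : ∀ y ∈ interior K₂, HasFDerivAt (logDetCombination J β)
      (∑ i, (β i * ((J i).rank : ℝ)⁻¹) • (((J i).det y)⁻¹ • fderiv ℝ (J i).det y)) y := by
    intro y hy
    refine HasFDerivAt.fun_sum fun i _ => HasFDerivAt.const_mul ?_ _
    exact ((J i).contDiff_det.differentiable one_ne_zero y).hasFDerivAt.log (hdet y hy i).ne'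
  have hgrad : ∀ y ∈ interior K₂, ∀ w, inner ℝ (gradient (logDetCombination J β) y) w
      = ∑ i, (β i * ((J i).rank : ℝ)⁻¹) * (J i).logDetDeriv y w := by
    intro y hy w
    rw [gradient, InnerProductSpace.toDual_symm_apply, (hfd y hy).fderiv]
    simp [EuclideanJordanProduct.logDetDeriv, div_eq_inv_mul]
  have hpos : ∀ y ∈ interior K₂, ∀ w ∈ K₂, w ≠ 0 →
      0 < inner ℝ (gradient (logDetCombination J β) y) w := by
    intro y hy w hw hw0
    rw [hgrad y hy]
    exact Finset.sum_pos (fun i _ => mul_pos (hγ i)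
      ((J i).logDetDeriv_pos (hmem y hy i) (hdet y hy i) (hsub i hw) hw0)) hne
  refine ⟨fun y hy => ⟨hdet y hy, (hfd y hy).differentiableAt, hpos y hy⟩, fun w hw => ?_⟩
  rcases eq_or_ne w 0 with rfl | hw0
  -- Here `Real.log 0 = 0` makes the function constant.
  · have : logGradientPairing (logDetCombination J β) 0 = fun _ => 0 := by
      funext y
      simp [logGradientPairing]
    rw [this]
    exact convexOn_const 0 hconv
  rw [convexOn_iff_forall_pos]
  refine ⟨hconv, fun x hx y hy a b ha hb hab => ?_⟩
  have hz := hconv hx hy ha.le hb.le hab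
  have hx0 := hpos x hx w hw hw0
  have hy0 := hpos y hy w hw hw0
  have hz0 := hpos _ hz w hw hw0
  simp only [logGradientPairing, smul_eq_mul]
  rw [← Real.log_rpow hx0, ← Real.log_rpow hy0,
    ← Real.log_mul (Real.rpow_pos_of_pos hx0 a).ne' (Real.rpow_pos_of_pos hy0 b).ne']
  refine Real.log_le_log hz0 ?_
  rw [hgrad _ hz, hgrad x hx, hgrad y hy]
  have hl : ∀ i, ∀ u ∈ interior K₂, 0 ≤ (J i).logDetDeriv u w := fun i u hu =>
    ((J i).logDetDeriv_pos (hmem u hu i) (hdet u hu i) (hsub i hw) hw0).le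
  refine le_trans (Finset.sum_le_sum fun i _ => ?_)
    (sum_rpow_mul_rpow_le _ (fun i _ => mul_nonneg (hγ i).le (hl i x hx))
      (fun i _ => mul_nonneg (hγ i).le (hl i y hy)) ha hb hab)
  have h1 := (J i).logDetDeriv_le_rpow (hmem x hx i) (hdet x hx i) (hmem y hy i) (hdet y hy i)
    (hsub i hw) ha hb hab
  -- As `a + b = 1`, each weight factors as `γ = γ ^ a * γ ^ b`, so Hölder absorbs it.
  rw [Real.mul_rpow (hγ i).le (hl i x hx), Real.mul_rpow (hγ i).le (hl i y hy),
    mul_mul_mul_comm, ← Real.rpow_add (hγ i), hab, Real.rpow_one]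
  exact mul_le_mul_of_nonneg_left h1 (hγ i).le
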